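/- Let $n\ge 1$ and let $\Phi_+=\{e_i-e_j : 0\le i<j\le n\}$ be the set of positive roots of type $A_n$, with simple roots $\alpha_k=e_k-e_{k+1}$ ($0\le k<n$). For $\mu$ in the root lattice, let $$K_q(\mu)=\sum_{(k_\alpha)} q^{|\{\alpha\,:\,k_\alpha>0\}|}\in\mathbb{Q}[q],$$ the sum being over all $(k_\alpha)\in\mathbb{N}^{\Phi_+}$ with $\sum_{\alpha\in\Phi_+} k_\alpha\alpha=\mu$. Let $M$ be the $n\times\binom{n+1}{2}$ matrix whose columns are the positive roots written in the basis of simple roots; for a set $\sigma$ of columns let $\mathrm{pos}(M_\sigma)\subseteq\mathbb{R}^n$ be the closed convex cone they span, and call $\sigma$ a basis if $|\sigma|=\mathrm{rank}(M_\sigma)=n$. The chamber complex $\mathcal{C}_n$ of the Kostant partition function is the common refinement of the simplicial cones $\mathrm{pos}(M_\sigma)$, $\sigma$ a basis: its cells are the sets $C(x)$, $x\in\mathrm{pos}(M)$, where $C(x)$ is the intersection of all faces of the cones $\mathrm{pos}(M_\sigma)$, $\sigma$ a basis, that contain $x$. Theorem. For every cell $C$ of $\mathcal{C}_n$ there is a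 polynomial $P\in\mathbb{Q}[q][x_1,\dots,x_n]$, of total degree at most $\binom{n}{2}$ in $x_1,\dots,x_n$ and with coefficients in $\mathbb{Q}[q]$ of degree at most $\binom{n+1}{2}$, such that $$K_q(v_1\alpha_0+\cdots+v_n\alpha_{n-1})=P(v_1,\dots,v_n)$$ for all $v\in\mathbb{Z}^n$ in the relative interior of $C$. If $C$ is full-dimensional, both degrees are attained: $P$ has total degree exactly $\binom{n}{2}$, and some coefficient of $P$ has degree exactly $\binom{n+1}{2}$ in $q$. -/

import Mathlib

open Polynomial

/-- Index set of the positive roots of type `A_n`: the pairs `i < j` in `{0, …, n}`. -/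
abbrev PosRootIdx (n : ℕ) : Type := {p : Fin (n + 1) × Fin (n + 1) // p.1 < p.2}

/-- The positive root `e_i - e_j` (`i < j`) of type `A_n`. -/
def posRoot (n : ℕ) (a : PosRootIdx n) : Fin (n + 1) → ℤ :=
  Pi.single a.1.1 1 - Pi.single a.1.2 1

/-- The simple root `e_k - e_{k+1}` of type `A_n`. -/
def simpleRoot (n : ℕ) (k : Fin n) : Fin (n + 1) → ℤ :=
  Pi.single k.castSucc 1 - Pi.single k.succ 1

/-- The matrix whose columns are the positive roots of type `A_n` written in the basis of simple
roots: `e_i - e_j` is the sum of the simple roots number `i, …, j - 1`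
(see `sum_rootMatrix_smul_simpleRoot`). -/
def rootMatrix (n : ℕ) : Matrix (Fin n) (PosRootIdx n) ℤ :=
  Matrix.of fun k a => if a.1.1 ≤ k.castSucc ∧ k.castSucc < a.1.2 then 1 else 0

/-- The columns of `rootMatrix n` are the coordinates of the positive roots. -/
theorem sum_rootMatrix_smul_simpleRoot (n : ℕ) (a : PosRootIdx n) :
    ∑ k, rootMatrix n k a • simpleRoot n k = posRoot n a := by
  obtain ⟨⟨i, j⟩, hij⟩ := a
  have hij' : (i : ℕ) < (j : ℕ) := hij
  funext t
  set F : ℕ → ℤ := fun k => if (t : ℕ) = k then 1 else 0 with hF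
  have h1 : (∑ k, rootMatrix n k ⟨(i, j), hij⟩ • simpleRoot n k) t =
      ∑ k : Fin n, (fun m : ℕ => if (i : ℕ) ≤ m ∧ m < (j : ℕ) then F m - F (m + 1) else 0) k := by
    rw [Finset.sum_apply]
    refine Finset.sum_congr rfl fun k _ => ?_
    simp [rootMatrix, simpleRoot, Pi.single_apply, hF, Fin.ext_iff, Fin.le_def, Fin.lt_def]
  have h2 : (Finset.range n).filter (fun m => (i : ℕ) ≤ m ∧ m < (j : ℕ)) =
      Finset.Ico (i : ℕ) j := by
    ext m
    simp only [Finset.mem_filter, Finset.mem_range, Finset.mem_Ico]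
    omega
  rw [h1, Fin.sum_univ_eq_sum_range (fun m : ℕ =>
    if (i : ℕ) ≤ m ∧ m < (j : ℕ) then F m - F (m + 1) else 0) n, ← Finset.sum_filter, h2]
  have h3 := Finset.sum_Ico_sub F hij'.le
  have h4 : ∑ m ∈ Finset.Ico (i : ℕ) j, (F m - F (m + 1)) = F i - F j := by
    rw [← neg_sub (F j), ← h3, ← Finset.sum_neg_distrib]
    exact Finset.sum_congr rfl fun m _ => by ring
  rw [h4]
  simp [posRoot, Pi.single_apply, hF, Fin.ext_iff]

/-- The decompositions `∑ k_α α = μ` of `μ` with natural coefficients `k_α`. -/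
def kostantSet (n : ℕ) (μ : Fin (n + 1) → ℤ) : Set (PosRootIdx n → ℕ) :=
  {k | ∑ a, (k a : ℤ) • posRoot n a = μ}

theorem kostantSet_finite (n : ℕ) (μ : Fin (n + 1) → ℤ) : (kostantSet n μ).Finite := by
  set h : ℤ := ∑ i : Fin (n + 1), -(i : ℤ) * μ i with hh
  refine (Set.finite_Iic (fun _ : PosRootIdx n => h.toNat)).subset ?_
  intro k hk a
  have hk' : ∑ a, (k a : ℤ) • posRoot n a = μ := hk
  have key : h = ∑ a : PosRootIdx n, (k a : ℤ) * ((a.1.2 : ℕ) - (a.1.1 : ℕ) : ℤ) := by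
    rw [hh, ← hk']
    simp only [Finset.sum_apply, Pi.smul_apply, smul_eq_mul, Finset.mul_sum]
    rw [Finset.sum_comm]
    refine Finset.sum_congr rfl fun b _ => ?_
    simp only [posRoot, Pi.sub_apply, Pi.single_apply, mul_sub, mul_ite, mul_one, mul_zero,
      Finset.sum_sub_distrib, Finset.sum_ite_eq', Finset.mem_univ, if_true]
    ring
  have hpos : ∀ b : PosRootIdx n, (1 : ℤ) ≤ ((b.1.2 : ℕ) - (b.1.1 : ℕ) : ℤ) := by
    intro b
    have hb : (b.1.1 : ℕ) < (b.1.2 : ℕ) := b.2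
    omega
  have h1 : (k a : ℤ) ≤ h := by
    rw [key]
    calc (k a : ℤ) ≤ (k a : ℤ) * ((a.1.2 : ℕ) - (a.1.1 : ℕ) : ℤ) :=
          le_mul_of_one_le_right (by positivity) (hpos a)
      _ ≤ _ := Finset.single_le_sum
          (f := fun b : PosRootIdx n => (k b : ℤ) * ((b.1.2 : ℕ) - (b.1.1 : ℕ) : ℤ))
          (fun b _ => mul_nonneg (by positivity) (by linarith [hpos b])) (Finset.mem_univ a)
  show k a ≤ h.toNat
  omega

/-- The `q`-analogue `K_q(μ) = ∑ q ^ #{α | k_α > 0}` of the Kostant partition function of type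
`A_n`, the sum running over all decompositions `μ = ∑ k_α α`, as a polynomial in `q`. -/
noncomputable def kostantQ (n : ℕ) (μ : Fin (n + 1) → ℤ) : ℚ[X] :=
  ∑ k ∈ (kostantSet_finite n μ).toFinset, X ^ (Finset.univ.filter fun a => 0 < k a).card

section ChamberComplex

variable {d : ℕ} {ι : Type} [Fintype ι]

/-- The cone `pos(M_σ)` spanned by the columns of `M` with index in `σ`. -/
def posCone (M : Matrix (Fin d) ι ℤ) (σ : Finset ι) : Set (Fin d → ℝ) :=
  (PointedCone.hull ℝ ((fun i r => (M r i : ℝ)) '' (σ : Set ι)) : Set (Fin d → ℝ))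

/-- `σ` indexes an invertible `d × d` submatrix `M_σ`. -/
def IsColumnBasis (M : Matrix (Fin d) ι ℤ) (σ : Finset ι) : Prop :=
  σ.card = d ∧ ((M.map (Int.cast : ℤ → ℝ)).submatrix id (Subtype.val : σ → ι)).rank = d

/-- The cell of the common refinement through `x`: the intersection of all faces through `x` of
the simplicial cones `pos(M_σ)`, `σ` a basis. The faces of the simplicial cone `pos(M_σ)` are the
cones `pos(M_ρ)` with `ρ ⊆ σ`. -/
def chamberCell (M : Matrix (Fin d) ι ℤ) (x : Fin d → ℝ) : Set (Fin d → ℝ) :=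
  {y | ∀ σ ρ : Finset ι, IsColumnBasis M σ → ρ ⊆ σ → x ∈ posCone M ρ → y ∈ posCone M ρ}

/-- The chamber complex of `M`, the common refinement of the cones `pos(M_σ)`, `σ` a basis:
the set of its (closed) cells, one through each point of `pos(M)`. -/
def chamberComplex (M : Matrix (Fin d) ι ℤ) : Set (Set (Fin d → ℝ)) :=
  {C | ∃ x ∈ posCone M Finset.univ, C = chamberCell M x}

end ChamberComplex

/-! Sort the decompositions by support: K_q(v) is the sum of q^|S| f_S(v), where f_S(v) counts those
with support exactly S. With y_a = x^a/(1 - x^a), f_S is the coefficient function of the product of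
the y_a over S, and `fiberSum hM m` is that of y^m.

A dependent S is rewritten (`fiberSum_mem_independentFiberSums`). Since y_a = x^a (1 + y_a), an
equality of column sums over disjoint A and B gives y^A ∏_B (1 + y_b) = y^B ∏_A (1 + y_a). After
expansion the products over A ∪ B cancel, and y^m becomes a combination of monomials with smaller
support or with less multiplicity away from one chosen column. The process ends in monomials with
independent support, and the bound |m| - rank(supp m) ≤ C(n,2) is kept throughout.

Type A enters through graphs: a set of positive roots is a forest, where deleting an edge yields an
integral functional dual to it, or has a cycle, which is a relation with coefficients ±1
(`hasIntegralDual_or_hasSignedRelation`). For an independent support σ at most one k with that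
support lies over v, and its coordinates are integral linear forms in v. So y^m contributes a
product of binomials of degree at most |m| - |σ| on the relative interior of pos(M_σ), and zero
elsewhere. On its lattice points the relative interior of a cell lies in that set or misses it
(`IsPosCombination.of_cell`), so f_S is there a polynomial of degree at most C(n,2).

On a full-dimensional cell nothing cancels at the top: only the set of all roots contributes to
q^C(n+1,2), and since the multiplicities of the C(n,2) nonsimple roots can be chosen freely, its
count grows at least like s^C(n,2) along a ray (`pow_le_fiberSum`). -/

/-- Integral functionals dual to the columns of `M` with index in `σ`. -/
def HasIntegralDual {d : ℕ} {ι : Type} (M : Matrix (Fin d) ι ℤ) (σ : Finset ι) : Prop :=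
  ∃ χ : ι → Fin d → ℤ, (∀ a ∈ σ, ∑ r, χ a r * M r a = 1) ∧
    ∀ a ∈ σ, ∀ b ∈ σ, b ≠ a → ∑ r, χ a r * M r b = 0

/-- A nontrivial linear relation with coefficients `0, 1, -1` between the columns of `M` with
index in `σ`. -/
def HasSignedRelation {d : ℕ} {ι : Type} (M : Matrix (Fin d) ι ℤ) (σ : Finset ι) : Prop :=
  ∃ A B : Finset ι, A ⊆ σ ∧ B ⊆ σ ∧ Disjoint A B ∧ B.Nonempty ∧
    ∀ r, ∑ a ∈ A, M r a = ∑ a ∈ B, M r a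

/-! ### Positive roots as edges: forests and cycles -/

section TypeA

variable {n : ℕ}

/-- The graph on `{0, …, n}` whose edges are the positive roots in `σ`. -/
def rootGraph (σ : Finset (PosRootIdx n)) : SimpleGraph (Fin (n + 1)) where
  Adj i j := ∃ a ∈ σ, (a.1.1 = i ∧ a.1.2 = j) ∨ (a.1.1 = j ∧ a.1.2 = i)
  symm := ⟨fun i j ⟨a, ha, h⟩ => ⟨a, ha, h.symm⟩⟩
  loopless := ⟨fun i ⟨a, _, h⟩ => by
    rcases h with h | h <;> exact a.2.ne (h.1.trans h.2.symm)⟩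

theorem rootGraph_adj_iff {σ : Finset (PosRootIdx n)} {i j : Fin (n + 1)} :
    (rootGraph σ).Adj i j ↔
      ∃ a ∈ σ, (a.1.1 = i ∧ a.1.2 = j) ∨ (a.1.1 = j ∧ a.1.2 = i) := Iff.rfl

theorem rootGraph_adj_of_mem {σ : Finset (PosRootIdx n)} {a : PosRootIdx n} (ha : a ∈ σ) :
    (rootGraph σ).Adj a.1.1 a.1.2 := ⟨a, ha, Or.inl ⟨rfl, rfl⟩⟩

/-- Edges traversed in the direction of their root go to `A`, the others to `B`, and the sum
telescopes along the path. The clause on `p.support` serves the induction: a new edge has an end off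
the remaining path, so it was not used before. -/
theorem exists_signed_sum_of_isPath (σ : Finset (PosRootIdx n)) {i j : Fin (n + 1)}
    (p : (rootGraph σ).Walk i j) (hp : p.IsPath) :
    ∃ A B : Finset (PosRootIdx n), A ⊆ σ ∧ B ⊆ σ ∧ Disjoint A B ∧
      (∀ a ∈ A ∪ B, a.1.1 ∈ p.support ∧ a.1.2 ∈ p.support) ∧
      ∑ a ∈ A, posRoot n a - ∑ a ∈ B, posRoot n a = Pi.single i 1 - Pi.single j 1 := by
  classical
  induction p with
  | nil => exact ⟨∅, ∅, by simp⟩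
  | @cons u w z h p ih =>
    rw [SimpleGraph.Walk.cons_isPath_iff] at hp
    obtain ⟨A, B, hA, hB, hAB, hsup, hsum⟩ := ih hp.1
    obtain ⟨a, ha, hends⟩ := rootGraph_adj_iff.1 h
    have hwp : w ∈ p.support := p.start_mem_support
    have haAB : a ∉ A ∪ B := by
      intro hmem
      rcases hends with hh | hh
      · exact hp.2 (hh.1 ▸ (hsup a hmem).1)
      · exact hp.2 (hh.2 ▸ (hsup a hmem).2)
    rw [Finset.mem_union, not_or] at haAB
    rcases hends with hh | hh
    · refine ⟨insert a A, B, Finset.insert_subset ha hA, hB, ?_, ?_, ?_⟩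
      · rw [Finset.disjoint_insert_left]
        exact ⟨haAB.2, hAB⟩
      · intro b hb
        rw [Finset.insert_union, Finset.mem_insert] at hb
        rcases hb with rfl | hb
        · simp only [SimpleGraph.Walk.support_cons, List.mem_cons, hh.1, hh.2, hwp, or_true, true_or,
          and_self]
        · simp only [SimpleGraph.Walk.support_cons, List.mem_cons, hsup b hb, or_true, and_self]
      · rw [Finset.sum_insert haAB.1, add_sub_assoc, hsum, posRoot, hh.1, hh.2]
        abel
    · refine ⟨A, insert a B, hA, Finset.insert_subset ha hB, ?_, ?_, ?_⟩
      · rw [Finset.disjoint_insert_right]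
        exact ⟨haAB.1, hAB⟩
      · intro b hb
        rw [Finset.union_insert, Finset.mem_insert] at hb
        rcases hb with rfl | hb
        · simp only [SimpleGraph.Walk.support_cons, List.mem_cons, hh.1, hh.2, hwp, or_true, true_or,
          and_self]
        · simp only [SimpleGraph.Walk.support_cons, List.mem_cons, hsup b hb, or_true, and_self]
      · rw [Finset.sum_insert haAB.2, add_comm (posRoot n a), ← sub_sub, hsum, posRoot, hh.1, hh.2]
        abel

/-- The simple roots are linearly independent. -/
theorem sum_smul_simpleRoot_injective :
    Function.Injective fun v : Fin n → ℤ => ∑ k, v k • simpleRoot n k := by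
  intro v w hvw
  -- The fundamental coweight, summation over the coordinates `0, …, r`, reads off the coefficient
  -- of the `r`-th simple root.
  have key : ∀ (v : Fin n → ℤ) (r : Fin n),
      ∑ t : Fin (n + 1), (if t ≤ r.castSucc then 1 else 0) * (∑ k, v k • simpleRoot n k) t
        = v r := by
    intro v r
    simp only [Finset.sum_apply, Pi.smul_apply, smul_eq_mul, Finset.mul_sum]
    rw [Finset.sum_comm, Finset.sum_eq_single r]
    · simp [simpleRoot, Pi.single_apply, mul_sub, Finset.sum_sub_distrib]
    · intro k _ hk
      have h1 : (k.castSucc ≤ r.castSucc) ↔ (k.succ ≤ r.castSucc) := by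
        simp only [Fin.le_def, Fin.val_castSucc, Fin.val_succ]
        have : (k : ℕ) ≠ r := fun h => hk (Fin.ext h)
        omega
      simp [simpleRoot, Pi.single_apply, mul_sub, Finset.sum_sub_distrib, h1]
    · simp
  funext r
  rw [← key v r, ← key w r]
  simp only at hvw
  rw [hvw]

theorem sum_rootMatrix_mul_smul_simpleRoot (c : PosRootIdx n → ℤ) :
    ∑ r, (∑ a, rootMatrix n r a * c a) • simpleRoot n r = ∑ a, c a • posRoot n a := by
  simp only [Finset.sum_smul, ← sum_rootMatrix_smul_simpleRoot, Finset.smul_sum]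
  rw [Finset.sum_comm]
  refine Finset.sum_congr rfl fun a _ => Finset.sum_congr rfl fun r _ => ?_
  rw [smul_smul, mul_comm]

theorem sum_rootMatrix_eq_of_sum_posRoot_eq {A B : Finset (PosRootIdx n)}
    (h : ∑ a ∈ A, posRoot n a = ∑ a ∈ B, posRoot n a) (r : Fin n) :
    ∑ a ∈ A, rootMatrix n r a = ∑ a ∈ B, rootMatrix n r a := by
  have key : ∀ A : Finset (PosRootIdx n),
      ∑ r, (∑ a ∈ A, rootMatrix n r a) • simpleRoot n r = ∑ a ∈ A, posRoot n a := by
    intro A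
    simp only [Finset.sum_smul, ← sum_rootMatrix_smul_simpleRoot]
    exact Finset.sum_comm
  have := sum_smul_simpleRoot_injective (n := n) (a₁ := fun r => ∑ a ∈ A, rootMatrix n r a)
    (a₂ := fun r => ∑ a ∈ B, rootMatrix n r a) (by simp only [key, h])
  exact congrFun this r

/-- A potential `φ` on the vertices is the functional `e_t ↦ φ t`; its values on the simple roots
are the differences of `φ`, and on a root the difference across the edge. -/
theorem sum_sub_mul_rootMatrix (φ : Fin (n + 1) → ℤ) (b : PosRootIdx n) :
    ∑ r : Fin n, (φ r.castSucc - φ r.succ) * rootMatrix n r b = φ b.1.1 - φ b.1.2 := by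
  have h := congrArg (fun w => ∑ t, φ t * w t) (sum_rootMatrix_smul_simpleRoot n b)
  simp only [Finset.sum_apply, Pi.smul_apply, smul_eq_mul, Finset.mul_sum] at h
  rw [Finset.sum_comm] at h
  have h2 : ∑ t, φ t * posRoot n b t = φ b.1.1 - φ b.1.2 := by
    simp [posRoot, Pi.single_apply, mul_sub, Finset.sum_sub_distrib]
  rw [← h2, ← h]
  refine Finset.sum_congr rfl fun r _ => ?_
  simp only [mul_left_comm _ (rootMatrix n r b), ← Finset.mul_sum]
  rw [mul_comm]
  simp [simpleRoot, Pi.single_apply, mul_sub, Finset.sum_sub_distrib]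

/-- A set of positive roots of type `A_n` is a forest, and then has an integral dual family, or
contains a cycle. -/
theorem hasIntegralDual_or_hasSignedRelation (σ : Finset (PosRootIdx n)) :
    HasIntegralDual (rootMatrix n) σ ∨ HasSignedRelation (rootMatrix n) σ := by
  classical
  -- An edge lies on a cycle exactly when its ends stay connected after its removal; the path
  -- between them, closed by `a`, is the relation.
  by_cases h : ∃ a ∈ σ, (rootGraph (σ.erase a)).Reachable a.1.1 a.1.2
  · right
    obtain ⟨a, ha, hr⟩ := h
    obtain ⟨p, hp⟩ := hr.exists_isPath
    obtain ⟨A, B, hA, hB, hAB, -, hsum⟩ := exists_signed_sum_of_isPath _ p hp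
    have haA : a ∉ A := fun h => Finset.notMem_erase a σ (hA h)
    have haB : a ∉ B := fun h => Finset.notMem_erase a σ (hB h)
    refine ⟨A, insert a B, hA.trans (Finset.erase_subset _ _),
      Finset.insert_subset ha (hB.trans (Finset.erase_subset _ _)), ?_,
      Finset.insert_nonempty _ _, sum_rootMatrix_eq_of_sum_posRoot_eq ?_⟩
    · rw [Finset.disjoint_insert_right]
      exact ⟨haA, hAB⟩
    · rw [Finset.sum_insert haB, ← sub_eq_iff_eq_add, hsum, posRoot]
  · left
    push Not at h
    -- The indicator of one of the two sides into which removing `a` cuts its component jumps only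
    -- across `a`.
    let φ : PosRootIdx n → Fin (n + 1) → ℤ := fun a t =>
      if (rootGraph (σ.erase a)).Reachable a.1.1 t then 1 else 0
    refine ⟨fun a r => φ a r.castSucc - φ a r.succ, fun a ha => ?_, fun a ha b hb hba => ?_⟩
    · rw [sum_sub_mul_rootMatrix]
      simp [φ, h a ha]
    · rw [sum_sub_mul_rootMatrix, sub_eq_zero]
      have hadj := (rootGraph_adj_of_mem (Finset.mem_erase.2 ⟨hba, hb⟩)).reachable
      have : (rootGraph (σ.erase a)).Reachable a.1.1 b.1.1 ↔
          (rootGraph (σ.erase a)).Reachable a.1.1 b.1.2 :=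
        ⟨fun h => h.trans hadj, fun h => h.trans hadj.symm⟩
      simp only [φ, this]

/-- The decompositions of `μ` into positive roots in simple root coordinates. -/
theorem mem_kostantSet_iff (v : Fin n → ℤ) (k : PosRootIdx n → ℕ) :
    k ∈ kostantSet n (∑ r, v r • simpleRoot n r) ↔
      ∀ r, ∑ a, rootMatrix n r a * (k a : ℤ) = v r := by
  rw [kostantSet, Set.mem_ofPred_eq, ← sum_rootMatrix_mul_smul_simpleRoot fun a => (k a : ℤ)]
  exact ⟨fun h => congrFun (sum_smul_simpleRoot_injective h),
    fun h => Finset.sum_congr rfl fun r _ => by rw [h r]⟩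

theorem rootMatrix_nonneg (r : Fin n) (a : PosRootIdx n) : 0 ≤ rootMatrix n r a := by
  rw [rootMatrix, Matrix.of_apply]
  split_ifs <;> simp

theorem exists_rootMatrix_pos (a : PosRootIdx n) : ∃ r, 0 < rootMatrix n r a := by
  obtain ⟨⟨i, j⟩, hij⟩ := a
  have hij' : (i : ℕ) < (j : ℕ) := hij
  refine ⟨⟨i, by omega⟩, ?_⟩
  simp [rootMatrix, Fin.le_def, Fin.lt_def, hij']

/-- The index of the simple root `e_r - e_{r+1}`. -/
def simpleIdx (r : Fin n) : PosRootIdx n := ⟨(r.castSucc, r.succ), Fin.castSucc_lt_succ⟩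

theorem simpleIdx_injective : Function.Injective (simpleIdx (n := n)) := fun _ _ h =>
  Fin.castSucc_injective n (congrArg (fun a : PosRootIdx n => a.1.1) h)

theorem rootMatrix_simpleIdx (r s : Fin n) :
    rootMatrix n r (simpleIdx s) = if r = s then 1 else 0 := by
  simp only [rootMatrix, Matrix.of_apply, simpleIdx, Fin.le_def, Fin.lt_def, Fin.val_castSucc,
    Fin.val_succ, Fin.ext_iff]
  congr 1
  apply propext
  omega

theorem card_posRootIdx : Fintype.card (PosRootIdx n) = (n + 1).choose 2 := by
  rw [Fintype.card_subtype, Finset.card_filter, ← Finset.univ_product_univ,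
    Finset.sum_product_right]
  simp only [← Finset.card_filter]
  have h : ∀ j : Fin (n + 1), (Finset.univ.filter fun i => i < j).card = (j : ℕ) := fun j => by
    rw [show (Finset.univ.filter fun i => i < j) = Finset.Iio j by ext; simp, Fin.card_Iio]
  simp only [h]
  rw [Fin.sum_univ_eq_sum_range (fun i => i), Finset.sum_range_id, Nat.choose_two_right]

end TypeA

/-! ### Powers of x / (1 - x) -/

/-- The number of ways to write `k` as an ordered sum of `m` positive integers, which is the
coefficient of `x ^ k` in `(x / (1 - x)) ^ m`. -/
def compositionCount : ℕ → ℕ → ℚ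
  | 0, 0 => 1
  | 0, _ + 1 => 0
  | _ + 1, 0 => 0
  | m + 1, k + 1 => k.choose m

/-- With y = x/(1 - x), this is y^(m+1) = x (y^m + y^(m+1)), a consequence of y = x (1 + y). -/
theorem compositionCount_succ_succ (m k : ℕ) :
    compositionCount (m + 1) (k + 1) = compositionCount m k + compositionCount (m + 1) k := by
  rcases m with _ | m <;> rcases k with _ | k <;>
    simp [compositionCount, Nat.choose_succ_succ]

theorem pos_iff_pos_of_compositionCount_ne_zero {m k : ℕ} (h : compositionCount m k ≠ 0) :
    0 < m ↔ 0 < k := by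
  rcases m with _ | m <;> rcases k with _ | k <;> simp_all [compositionCount]

/-! ### Fibre sums and the identity coming from a signed relation -/

section FiberSum

variable {d : ℕ} {ι : Type} [Fintype ι]

/-- The support of a vector of multiplicities. -/
def multSupport (m : ι → ℕ) : Finset ι := Finset.univ.filter fun a => 0 < m a

theorem mem_multSupport {m : ι → ℕ} {a : ι} : a ∈ multSupport m ↔ 0 < m a := by
  simp [multSupport]

/-- The natural solutions `k` of `M k = v`. -/
def natFiber (M : Matrix (Fin d) ι ℤ) (v : Fin d → ℤ) : Set (ι → ℕ) :=
  {k | ∀ r, ∑ a, M r a * (k a : ℤ) = v r}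

theorem mem_natFiber {M : Matrix (Fin d) ι ℤ} {v : Fin d → ℤ} {k : ι → ℕ} :
    k ∈ natFiber M v ↔ ∀ r, ∑ a, M r a * (k a : ℤ) = v r := Iff.rfl

/-- The matrices with nonnegative entries and nonzero columns. -/
structure IsPositive (M : Matrix (Fin d) ι ℤ) : Prop where
  nonneg : ∀ r a, 0 ≤ M r a
  exists_pos : ∀ a, ∃ r, 0 < M r a

theorem IsPositive.natFiber_finite {M : Matrix (Fin d) ι ℤ} (hM : IsPositive M)
    (v : Fin d → ℤ) : (natFiber M v).Finite := by
  classical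
  refine (Set.finite_Iic (fun _ : ι => ∑ r, (v r).toNat)).subset fun k hk a => ?_
  obtain ⟨r, hr⟩ := hM.exists_pos a
  have h1 : (k a : ℤ) ≤ v r := by
    rw [← mem_natFiber.1 hk r]
    calc (k a : ℤ) ≤ M r a * k a := le_mul_of_one_le_left (by positivity) hr
      _ ≤ _ := Finset.single_le_sum (f := fun b => M r b * (k b : ℤ))
          (fun b _ => mul_nonneg (hM.nonneg r b) (by positivity)) (Finset.mem_univ a)
  have h2 : (v r).toNat ≤ ∑ r, (v r).toNat :=
    Finset.single_le_sum (f := fun r => (v r).toNat) (fun _ _ => Nat.zero_le _)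
      (Finset.mem_univ r)
  show k a ≤ ∑ r, (v r).toNat
  omega

variable {M : Matrix (Fin d) ι ℤ} (hM : IsPositive M)

/-- The coefficient at `x ^ v` of `∏ a, (x ^ a / (1 - x ^ a)) ^ m a`, `a` running over the columns
of `M`. -/
noncomputable def fiberSum (m : ι → ℕ) (v : Fin d → ℤ) : ℚ :=
  ∑ k ∈ (hM.natFiber_finite v).toFinset, ∏ a, compositionCount (m a) (k a)

variable [DecidableEq ι]

/-- The indicator function of a finite set. -/
def finsetIndicator (T : Finset ι) : ι → ℕ := fun a => if a ∈ T then 1 else 0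

theorem sum_powerset_prod_indicator (F : ι → ℕ → ℚ) (B : Finset ι) :
    ∑ T ∈ B.powerset, ∏ a, F a (finsetIndicator T a) =
      ∏ a, if a ∈ B then F a 0 + F a 1 else F a 0 := by
  have h1 : ∏ a, (if a ∈ B then F a 0 + F a 1 else F a 0) =
      (∏ a ∈ B, (F a 1 + F a 0)) * ∏ a ∈ Bᶜ, F a 0 := by
    rw [← Finset.prod_mul_prod_compl B]
    congr 1
    · exact Finset.prod_congr rfl fun a ha => by rw [if_pos ha, add_comm]
    · exact Finset.prod_congr rfl fun a ha => by rw [if_neg (Finset.mem_compl.1 ha)]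
  rw [h1, Finset.prod_add, Finset.sum_mul]
  refine Finset.sum_congr rfl fun T hT => ?_
  rw [Finset.mem_powerset] at hT
  rw [← Finset.prod_mul_prod_compl B, ← Finset.prod_sdiff hT, mul_comm (∏ a ∈ B \ T, _)]
  congr 1
  · congr 1
    · exact Finset.prod_congr rfl fun a ha => by rw [finsetIndicator, if_pos ha]
    · exact Finset.prod_congr rfl fun a ha => by
        rw [finsetIndicator, if_neg (Finset.mem_sdiff.1 ha).2]
  · exact Finset.prod_congr rfl fun a ha => by
      rw [finsetIndicator, if_neg fun h => Finset.mem_compl.1 ha (hT h)]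

/-- Each factor in `A` is rewritten by y^(p+1) = x (y^p + y^(p+1)). On fibres this is the shift by
the indicator of `A`; a point outside its image vanishes somewhere on `A`, where the exponent `p a +
1` is positive and the weight is zero. -/
theorem sum_natFiber_shift (A : Finset ι) (p : ι → ℕ) (W : ι → ℕ → ℚ) (v : Fin d → ℤ) :
    ∑ k ∈ (hM.natFiber_finite v).toFinset,
        ∏ a, (if a ∈ A then compositionCount (p a + 1) (k a) else W a (k a)) =
      ∑ k ∈ (hM.natFiber_finite fun r => v r - ∑ a ∈ A, M r a).toFinset,
        ∏ a, (if a ∈ A then compositionCount (p a) (k a) + compositionCount (p a + 1) (k a)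
          else W a (k a)) := by
  have hsum : ∀ (k : ι → ℕ) r, ∑ a, M r a * ((k + finsetIndicator A) a : ℤ) =
      ∑ a, M r a * (k a : ℤ) + ∑ a ∈ A, M r a := by
    intro k r
    simp [finsetIndicator, mul_add, Finset.sum_add_distrib]
  symm
  refine Finset.sum_of_injOn (fun k => k + finsetIndicator A) ?_ ?_ ?_ ?_
  · exact fun k _ l _ h => add_right_cancel h
  · intro k hk
    simp only [Set.Finite.coe_toFinset, mem_natFiber] at hk ⊢
    intro r
    rw [← sub_add_cancel (v r) (∑ a ∈ A, M r a), ← hk r]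
    exact_mod_cast hsum k r
  · intro k hk hk'
    by_contra hne
    refine hk' ⟨k - finsetIndicator A, ?_, ?_⟩
    all_goals
      have hle : finsetIndicator A ≤ k := by
        intro a
        by_cases ha : a ∈ A
        · have h0 := Finset.prod_ne_zero_iff.1 hne a (Finset.mem_univ a)
          rw [if_pos ha] at h0
          have := (pos_iff_pos_of_compositionCount_ne_zero h0).1 (Nat.succ_pos _)
          simp only [finsetIndicator, if_pos ha]
          omega
        · simp [finsetIndicator, ha]
    · simp only [Set.Finite.coe_toFinset, Set.Finite.mem_toFinset, mem_natFiber] at hk ⊢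
      intro r
      have := hsum (k - finsetIndicator A) r
      rw [← hk r, eq_sub_iff_add_eq, ← this]
      refine Finset.sum_congr rfl fun a _ => ?_
      have := congrFun (tsub_add_cancel_of_le hle) a
      rw [Pi.add_apply] at this
      push_cast [Pi.add_apply]
      rw [← this]
      push_cast
      rfl
    · exact tsub_add_cancel_of_le hle
  · intro k _
    refine Finset.prod_congr rfl fun a _ => ?_
    by_cases ha : a ∈ A
    · simp [ha, finsetIndicator, compositionCount_succ_succ]
    · simp [ha, finsetIndicator]

/-- In generating functions, y^p ∏_A y_a ∏_B (1 + y_b) equals x^(∑A) y^p ∏_{A ∪ B} (1 + y_a). The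
right side sees `A` and `B` only through their union and the column sum of `A`, hence is symmetric
once the two column sums agree. -/
theorem sum_powerset_fiberSum_eq {A B : Finset ι} (hAB : Disjoint A B) (p : ι → ℕ)
    (v : Fin d → ℤ) :
    ∑ T ∈ B.powerset, fiberSum hM (p + finsetIndicator A + finsetIndicator T) v =
      ∑ k ∈ (hM.natFiber_finite fun r => v r - ∑ a ∈ A, M r a).toFinset,
        ∏ a, (if a ∈ A ∪ B then compositionCount (p a) (k a) + compositionCount (p a + 1) (k a)
          else compositionCount (p a) (k a)) := by
  simp only [fiberSum]
  rw [Finset.sum_comm]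
  have h := sum_natFiber_shift hM A p (fun a k => if a ∈ B then
    compositionCount (p a) k + compositionCount (p a + 1) k else compositionCount (p a) k) v
  have h2 : ∀ (k : ι → ℕ), (∏ a, (if a ∈ A ∪ B then
      compositionCount (p a) (k a) + compositionCount (p a + 1) (k a)
      else compositionCount (p a) (k a))) = ∏ a, (if a ∈ A then
      compositionCount (p a) (k a) + compositionCount (p a + 1) (k a) else if a ∈ B then
    compositionCount (p a) (k a) + compositionCount (p a + 1) (k a)
    else compositionCount (p a) (k a)) := by
    intro k
    refine Finset.prod_congr rfl fun a _ => ?_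
    by_cases hA : a ∈ A <;> by_cases hB : a ∈ B <;> simp [hA, hB]
  simp only [h2]
  rw [← h]
  refine Finset.sum_congr rfl fun k _ => ?_
  refine (sum_powerset_prod_indicator
    (fun a t => compositionCount (p a + finsetIndicator A a + t) (k a)) B).trans ?_
  refine Finset.prod_congr rfl fun a _ => ?_
  by_cases hA : a ∈ A
  · simp [hA, Finset.disjoint_left.1 hAB hA, finsetIndicator]
  · simp [hA, finsetIndicator]

/-- The relation between the functions `fiberSum` that comes from a signed relation between the
columns. -/
theorem sum_powerset_fiberSum_comm {A B : Finset ι} (hAB : Disjoint A B)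
    (h : ∀ r, ∑ a ∈ A, M r a = ∑ a ∈ B, M r a) (p : ι → ℕ) :
    ∑ T ∈ B.powerset, fiberSum hM (p + finsetIndicator A + finsetIndicator T) =
      ∑ T ∈ A.powerset, fiberSum hM (p + finsetIndicator B + finsetIndicator T) := by
  funext v
  rw [Finset.sum_apply, Finset.sum_apply, sum_powerset_fiberSum_eq hM hAB,
    sum_powerset_fiberSum_eq hM hAB.symm, Finset.union_comm]
  simp only [h]

end FiberSum

/-! ### Rank of a set of columns -/

section ColumnRank

variable {d : ℕ} {ι : Type} (M : Matrix (Fin d) ι ℤ)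

/-- A column of `M`, as a real vector. -/
def realColumn (a : ι) : Fin d → ℝ := fun r => (M r a : ℝ)

/-- The rank of the columns of `M` with index in `S`. -/
noncomputable def columnRank (S : Finset ι) : ℕ :=
  Module.finrank ℝ (Submodule.span ℝ (realColumn M '' (S : Set ι)))

theorem columnRank_le_card (S : Finset ι) : columnRank M S ≤ S.card := by
  classical
  have := finrank_span_finset_le_card (R := ℝ) (S.image (realColumn M))
  rw [Finset.coe_image] at this
  exact this.trans Finset.card_image_le

variable {M}

theorem HasSignedRelation.realColumn_mem_span {A B : Finset ι} [DecidableEq ι]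
    (hAB : Disjoint A B) (h : ∀ r, ∑ a ∈ A, M r a = ∑ a ∈ B, M r a) {S : Finset ι} (hA : A ⊆ S)
    (hB : B ⊆ S) {a : ι} (ha : a ∈ A) :
    realColumn M a ∈ Submodule.span ℝ (realColumn M '' (S.erase a : Set ι)) := by
  have hsum : ∑ b ∈ A, realColumn M b = ∑ b ∈ B, realColumn M b := by
    funext r
    simp only [Finset.sum_apply, realColumn]
    exact_mod_cast h r
  rw [← Finset.add_sum_erase _ _ ha, ← eq_sub_iff_add_eq] at hsum
  rw [hsum]
  refine Submodule.sub_mem _ ?_ ?_ <;> refine Submodule.sum_mem _ fun b hb => ?_ <;>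
    refine Submodule.subset_span ⟨b, ?_, rfl⟩
  · have : b ≠ a := fun e => Finset.disjoint_left.1 hAB ha (e ▸ hb)
    exact Finset.mem_coe.2 (Finset.mem_erase.2 ⟨this, hB hb⟩)
  · exact Finset.mem_coe.2 (Finset.mem_erase.2 ⟨(Finset.mem_erase.1 hb).1,
      hA (Finset.mem_erase.1 hb).2⟩)

variable [DecidableEq ι]

theorem columnRank_le_sdiff_add_card (S E : Finset ι) :
    columnRank M S ≤ columnRank M (S \ E) + E.card := by
  refine le_trans ?_ (Nat.add_le_add_left (columnRank_le_card M E) _)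
  refine le_trans ?_ (Submodule.finrank_add_le_finrank_add_finrank _ _)
  refine Submodule.finrank_mono ?_
  rw [← Submodule.span_union, ← Set.image_union, ← Finset.coe_union]
  refine Submodule.span_mono (Set.image_mono ?_)
  rw [Finset.coe_subset]
  simp

/-- The column `a` can be dropped at no cost, so removing `E` lowers the rank by at most |E| - 1.
The unit saved pays for the additional factor y_j in the reduction. -/
theorem columnRank_add_one_le_of_mem_span {S E : Finset ι} {a : ι} (ha : a ∈ E)
    (h : realColumn M a ∈ Submodule.span ℝ (realColumn M '' (S.erase a : Set ι))) :
    columnRank M S + 1 ≤ columnRank M (S \ E) + E.card := by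
  have h1 : columnRank M S ≤ columnRank M (S.erase a) := by
    refine Submodule.finrank_mono (Submodule.span_le.2 ?_)
    rintro _ ⟨b, hb, rfl⟩
    by_cases hba : b = a
    · rw [hba]; exact h
    · exact Submodule.subset_span ⟨b, Finset.mem_coe.2 (Finset.mem_erase.2 ⟨hba, hb⟩), rfl⟩
  have h2 := columnRank_le_sdiff_add_card (M := M) (S.erase a) (E.erase a)
  have h3 : S.erase a \ E.erase a = S \ E := by
    ext b
    simp only [Finset.mem_sdiff, Finset.mem_erase]
    by_cases hba : b = a
    · subst hba; simp [ha]
    · simp [hba]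
  rw [h3] at h2
  have := Finset.card_erase_add_one ha
  omega

end ColumnRank

/-! ### Reduction to independent supports -/

section Reduction

variable {d : ℕ} {ι : Type} [Fintype ι] [DecidableEq ι] {M : Matrix (Fin d) ι ℤ}
  (hM : IsPositive M)

/-- The span of the functions `fiberSum` of the families of multiplicities with an independent
support and bounded excess. -/
noncomputable def independentFiberSums : Submodule ℚ ((Fin d → ℤ) → ℚ) :=
  Submodule.span ℚ {f | ∃ m : ι → ℕ, HasIntegralDual M (multSupport m) ∧
    ∑ a, m a + d ≤ Fintype.card ι + (multSupport m).card ∧ f = fiberSum hM m}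

theorem sum_add_indicator_sub {m : ι → ℕ} {j : ι} {D : Finset ι} (hD : ∀ a ∈ D, 0 < m a) :
    ∑ a, (m + finsetIndicator {j} - finsetIndicator D) a + D.card = ∑ a, m a + 1 := by
  have h1 : ∀ T : Finset ι, ∑ a, finsetIndicator T a = T.card := fun T => by
    simp [finsetIndicator]
  have hle : finsetIndicator D ≤ m + finsetIndicator {j} := fun a => by
    by_cases ha : a ∈ D
    · have := hD a ha
      simp only [finsetIndicator, if_pos ha, Pi.add_apply]
      omega
    · simp [finsetIndicator, ha]
  rw [← h1 D, ← Finset.sum_add_distrib]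
  have : ∀ a, (m + finsetIndicator {j} - finsetIndicator D) a + finsetIndicator D a =
      m a + finsetIndicator {j} a := congrFun (tsub_add_cancel_of_le hle)
  simp only [this, Finset.sum_add_distrib, h1, Finset.card_singleton]

/-- The functions `fiberSum` are combinations of those with an independent support, if every
dependent set of columns satisfies a signed relation. -/
theorem fiberSum_mem_independentFiberSums
    (hdich : ∀ σ, HasIntegralDual M σ ∨ HasSignedRelation M σ) (m : ι → ℕ)
    (hm : ∑ a, m a + d ≤ Fintype.card ι + columnRank M (multSupport m)) :
    fiberSum hM m ∈ independentFiberSums hM := by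
  obtain ⟨S, hS⟩ : ∃ S, multSupport m = S := ⟨_, rfl⟩
  induction S using Finset.strongInduction generalizing m with
  | H S IH =>
  rcases hdich S with hdual | ⟨A, B, hA, hB, hAB, ⟨j, hj⟩, hrel⟩
  · refine Submodule.subset_span ⟨m, hS ▸ hdual, ?_, rfl⟩
    have := columnRank_le_card M (multSupport m)
    omega
  -- The exponent of `j` may grow, so for a fixed support the induction runs on the total
  -- multiplicity away from `j`.
  obtain ⟨q, hq⟩ : ∃ q, ∑ a ∈ Finset.univ.erase j, m a = q := ⟨_, rfl⟩
  induction q using Nat.strong_induction_on generalizing m with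
  | _ q IH' =>
  have hmem : ∀ {a}, a ∈ S ↔ 0 < m a := fun {a} => by rw [← hS, mem_multSupport]
  have hspan : ∀ a ∈ A ∪ B,
      realColumn M a ∈ Submodule.span ℝ (realColumn M '' (S.erase a : Set ι)) := by
    intro a ha
    rcases Finset.mem_union.1 ha with ha | ha
    · exact HasSignedRelation.realColumn_mem_span hAB hrel hA hB ha
    · exact HasSignedRelation.realColumn_mem_span hAB.symm (fun r => (hrel r).symm) hB hA ha
  have key : ∀ D, D ⊆ A ∪ B → D.Nonempty → D ≠ {j} →
      fiberSum hM (m + finsetIndicator {j} - finsetIndicator D) ∈ independentFiberSums hM := by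
    intro D hDAB hD hDj
    have hDS : ∀ a ∈ D, 0 < m a := fun a ha =>
      hmem.1 (Finset.union_subset hA hB (hDAB ha))
    have hsum := sum_add_indicator_sub (j := j) hDS
    set m' := m + finsetIndicator {j} - finsetIndicator D with hm'
    have hval : ∀ a, m' a = m a + (if a = j then 1 else 0) - (if a ∈ D then 1 else 0) := by
      intro a
      simp [hm', finsetIndicator]
    have hsub : multSupport m' ⊆ S := by
      intro a ha
      rw [mem_multSupport, hval] at ha
      by_cases haj : a = j
      · exact haj ▸ hB hj
      · rw [hmem]
        simp only [if_neg haj] at ha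
        omega
    have hE : S \ multSupport m' ⊆ D := by
      intro a ha
      rw [Finset.mem_sdiff, hmem, mem_multSupport, hval] at ha
      by_contra haD
      simp only [if_neg haD] at ha
      omega
    -- Here |m'| = |m| + 1 - |D|. If the support is unchanged, `D` being nonempty suffices;
    -- otherwise the rank falls by less than the number of lost columns, all of which lie in `D`.
    have hineq : ∑ a, m' a + d ≤ Fintype.card ι + columnRank M (multSupport m') := by
      have hDcard := hD.card_pos
      rcases (S \ multSupport m').eq_empty_or_nonempty with hemp | ⟨a, ha⟩
      · have : multSupport m' = S :=
          Finset.Subset.antisymm hsub (Finset.sdiff_eq_empty_iff_subset.1 hemp)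
        rw [this]
        rw [hS] at hm
        omega
      · have h1 := columnRank_add_one_le_of_mem_span ha (hspan a (hDAB (hE ha)))
        rw [Finset.sdiff_sdiff_eq_self hsub] at h1
        have h2 := Finset.card_le_card hE
        rw [hS] at hm
        omega
    rcases hsub.eq_or_ssubset with heq | hss
    · refine IH' _ ?_ m' hineq heq rfl
      rw [← hq]
      obtain ⟨a, haD, haj⟩ : ∃ a ∈ D, a ≠ j := by
        by_contra hcon
        push Not at hcon
        exact hDj (Finset.eq_singleton_iff_nonempty_unique_mem.2 ⟨hD, hcon⟩)
      refine Finset.sum_lt_sum (fun b hb => ?_) ⟨a, Finset.mem_erase.2 ⟨haj, Finset.mem_univ a⟩, ?_⟩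
      · rw [hval, if_neg (Finset.mem_erase.1 hb).1]
        omega
      · rw [hval, if_neg haj, if_pos haD]
        have := hDS a haD
        omega
    · exact IH _ hss m' hineq rfl
  -- Chosen so that y^p times the product over (A ∪ B) \ {j} is y^m. The subtraction is not
  -- truncated, because `m` is positive on A ∪ B.
  set p := m + finsetIndicator {j} - finsetIndicator (A ∪ B) with hp
  have hrel' := sum_powerset_fiberSum_comm hM hAB hrel p
  have hshift : ∀ A' B', Disjoint A' B' → A' ∪ B' = A ∪ B → ∀ T ∈ B'.powerset,
      p + finsetIndicator A' + finsetIndicator T =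
        m + finsetIndicator {j} - finsetIndicator (B' \ T) := by
    intro A' B' hdis hun T hT
    rw [Finset.mem_powerset] at hT
    funext a
    have hpos : a ∈ A' ∪ B' → 0 < m a := fun h => hmem.1 (Finset.union_subset hA hB (hun ▸ h))
    simp only [hp, ← hun, finsetIndicator, Pi.add_apply, Pi.sub_apply, Finset.mem_union,
      Finset.mem_sdiff, Finset.mem_singleton] at hpos ⊢
    by_cases h1 : a ∈ A'
    · have h2 := Finset.disjoint_left.1 hdis h1
      have h3 : a ∉ T := fun h => h2 (hT h)
      have := hpos (Or.inl h1)
      simp only [h1, h2, h3, true_or, if_true, false_and, if_false]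
      omega
    · by_cases h2 : a ∈ B'
      · have := hpos (Or.inr h2)
        by_cases h3 : a ∈ T <;>
        simp only [h1, h2, h3, or_true, if_true, not_true, not_false_iff,
          and_false, and_true, if_false] <;> omega
      · have h3 : a ∉ T := fun h => h2 (hT h)
        simp [h1, h2, h3]
  -- The terms `T = B` and `T = A` are both y^m y_j and cancel; the term `T = B.erase j` is y^m. All
  -- others fall under `key`.
  rw [Finset.sum_congr rfl fun T hT => by rw [hshift A B hAB rfl T hT],
    Finset.sum_congr (s₁ := A.powerset) rfl fun T hT => by
      rw [hshift B A hAB.symm (Finset.union_comm _ _) T hT],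
    ← Finset.add_sum_erase _ _ (Finset.mem_powerset_self B),
    ← Finset.add_sum_erase _ _ (Finset.mem_powerset_self A), Finset.sdiff_self,
    Finset.sdiff_self, add_right_inj,
    ← Finset.add_sum_erase _ _ (show B.erase j ∈ B.powerset.erase B from
      Finset.mem_erase.2 ⟨(Finset.erase_ssubset hj).ne, Finset.mem_powerset.2
        (Finset.erase_subset _ _)⟩), Finset.sdiff_erase_self hj, add_tsub_cancel_right,
    ← eq_sub_iff_add_eq] at hrel'
  rw [hrel']
  refine Submodule.sub_mem _ (Submodule.sum_mem _ fun T hT => ?_)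
    (Submodule.sum_mem _ fun T hT => ?_)
  · rw [Finset.mem_erase, Finset.mem_powerset] at hT
    refine key _ (Finset.sdiff_subset.trans Finset.subset_union_left)
      (Finset.sdiff_nonempty.2 fun h => hT.1 (Finset.Subset.antisymm hT.2 h)) fun h => ?_
    have : j ∈ A \ T := h ▸ Finset.mem_singleton_self j
    exact Finset.disjoint_left.1 hAB (Finset.mem_sdiff.1 this).1 hj
  · rw [Finset.mem_erase, Finset.mem_erase, Finset.mem_powerset] at hT
    refine key _ (Finset.sdiff_subset.trans Finset.subset_union_right)
      (Finset.sdiff_nonempty.2 fun h => hT.2.1 (Finset.Subset.antisymm hT.2.2 h)) fun h => hT.1 ?_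
    rw [← Finset.sdiff_sdiff_eq_self hT.2.2, h, Finset.sdiff_singleton_eq_erase]

end Reduction

/-! ### Simplicial cones and relative interiors of cells -/

theorem exists_pos_add_smul_sub_mem_of_mem_intrinsicInterior {E : Type*} [NormedAddCommGroup E]
    [NormedSpace ℝ E] {C : Set E} {x y : E} (hx : x ∈ C) (hy : y ∈ intrinsicInterior ℝ C) :
    ∃ ε : ℝ, 0 < ε ∧ y + ε • (y - x) ∈ C := by
  obtain ⟨y', hy', rfl⟩ := mem_intrinsicInterior.1 hy
  -- The line through `x` and `y` stays in the affine span, so it can be prolonged slightly past `y`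
  -- without leaving `C`.
  let z : ℝ → affineSpan ℝ C := fun t => ⟨AffineMap.lineMap x (y' : E) t,
    AffineMap.lineMap_mem t (subset_affineSpan ℝ C hx) y'.2⟩
  have hz : Continuous z := by
    refine Continuous.subtype_mk ?_ _
    exact AffineMap.lineMap_continuous
  have hz1 : z 1 = y' := Subtype.ext (AffineMap.lineMap_apply_one _ _)
  have hnhds : ∀ᶠ t in nhds (1 : ℝ), z t ∈ interior ((↑) ⁻¹' C : Set (affineSpan ℝ C)) :=
    hz.continuousAt.eventually_mem (hz1 ▸ isOpen_interior.mem_nhds hy')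
  obtain ⟨δ, hδ, hball⟩ := Metric.eventually_nhds_iff.1 hnhds
  refine ⟨δ / 2, by positivity, ?_⟩
  have h := interior_subset (hball (y := 1 + δ / 2) (by
    rw [Real.dist_eq, add_sub_cancel_left, abs_of_pos (by positivity)]; linarith))
  have h2 : AffineMap.lineMap x (y' : E) (1 + δ / 2) = (y' : E) + (δ / 2) • ((y' : E) - x) := by
    rw [AffineMap.lineMap_apply, vsub_eq_sub, vadd_eq_add, add_smul, one_smul]
    abel
  rw [← h2]
  exact h

theorem mem_chamberCell_self {d : ℕ} {ι : Type} {M : Matrix (Fin d) ι ℤ} (x : Fin d → ℝ) :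
    x ∈ chamberCell M x := fun _ _ _ _ h => h

/-- By positivity neither side of a relation is empty, so the two sides may be exchanged to make `A`
the cheaper one. -/
theorem HasSignedRelation.exists_cost_le {d : ℕ} {ι : Type} {M : Matrix (Fin d) ι ℤ}
    (hM : IsPositive M) {σ : Finset ι} (h : HasSignedRelation M σ) (w : ι → ℝ) :
    ∃ A B : Finset ι, A ⊆ σ ∧ B ⊆ σ ∧ Disjoint A B ∧ B.Nonempty ∧
      (∀ r, ∑ a ∈ A, M r a = ∑ a ∈ B, M r a) ∧ ∑ a ∈ A, w a ≤ ∑ a ∈ B, w a := by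
  obtain ⟨A, B, hA, hB, hAB, hBne, hrel⟩ := h
  have hAne : A.Nonempty := by
    obtain ⟨b, hb⟩ := hBne
    obtain ⟨r, hr⟩ := hM.exists_pos b
    rw [Finset.nonempty_iff_ne_empty]
    rintro rfl
    have h1 := hrel r
    rw [Finset.sum_empty] at h1
    have : M r b ≤ ∑ a ∈ B, M r a :=
      Finset.single_le_sum (f := fun a => M r a) (fun a _ => hM.nonneg r a) hb
    omega
  rcases le_total (∑ a ∈ A, w a) (∑ a ∈ B, w a) with hle | hle
  · exact ⟨A, B, hA, hB, hAB, hBne, hrel, hle⟩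
  · exact ⟨B, A, hB, hA, hAB.symm, hAne, fun r => (hrel r).symm, hle⟩

section Cones

variable {d : ℕ} {ι : Type} [Fintype ι] {M : Matrix (Fin d) ι ℤ}

theorem mem_posCone_iff {σ : Finset ι} {y : Fin d → ℝ} :
    y ∈ posCone M σ ↔ ∃ k : ι → ℝ, (∀ a, 0 ≤ k a) ∧ (∀ a ∉ σ, k a = 0) ∧
      ∀ r, ∑ a, (M r a : ℝ) * k a = y r := by
  classical
  rw [posCone, SetLike.mem_coe]
  refine (Submodule.mem_span_image_finset_iff_exists_fun' _).trans ⟨?_, ?_⟩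
  · rintro ⟨c, hc⟩
    refine ⟨fun a => if a ∈ σ then (c a : ℝ) else 0, fun a => ?_, fun a ha => if_neg ha,
      fun r => ?_⟩
    · dsimp only
      split_ifs
      exacts [(c a).2, le_rfl]
    · rw [← hc]
      simp only [mul_ite, mul_zero, Finset.sum_ite_mem, Finset.univ_inter, Finset.sum_apply]
      exact Finset.sum_congr rfl fun a _ => mul_comm _ _
  · rintro ⟨k, hk, hσ, hy⟩
    refine ⟨fun a => ⟨k a, hk a⟩, ?_⟩
    funext r
    rw [← hy r, Finset.sum_apply, ← Finset.sum_subset (Finset.subset_univ σ) fun a _ ha => by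
      rw [hσ a ha, mul_zero]]
    exact Finset.sum_congr rfl fun a _ => mul_comm _ _

variable (M) in
/-- The points of the relative interior of `pos(M_σ)`: the combinations of the columns in `σ` with
positive coefficients. -/
def IsPosCombination (σ : Finset ι) (y : Fin d → ℝ) : Prop :=
  ∃ k : ι → ℝ, (∀ a ∈ σ, 0 < k a) ∧ (∀ a ∉ σ, k a = 0) ∧ ∀ r, ∑ a, (M r a : ℝ) * k a = y r

theorem IsPosCombination.mem_posCone {σ : Finset ι} {y : Fin d → ℝ}
    (h : IsPosCombination M σ y) : y ∈ posCone M σ := by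
  obtain ⟨k, hk, hσ, hy⟩ := h
  refine mem_posCone_iff.2 ⟨k, fun a => ?_, hσ, hy⟩
  by_cases ha : a ∈ σ
  exacts [(hk a ha).le, (hσ a ha).ge]

/-- The dual functionals recover the coefficients. The ring is general because both real points of
cones and integral points of fibres need this. -/
theorem dual_apply_eq {R : Type*} [CommRing R] {σ : Finset ι} {χ : ι → Fin d → ℤ}
    (h1 : ∀ a ∈ σ, ∑ r, χ a r * M r a = 1)
    (h0 : ∀ a ∈ σ, ∀ b ∈ σ, b ≠ a → ∑ r, χ a r * M r b = 0) {k : ι → R} {y : Fin d → R}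
    (hσ : ∀ a ∉ σ, k a = 0) (hy : ∀ r, ∑ a, (M r a : R) * k a = y r) {a : ι} (ha : a ∈ σ) :
    ∑ r, (χ a r : R) * y r = k a := by
  classical
  have h : ∀ b, ∑ r, (χ a r : R) * ((M r b : R) * k b) = if b = a then k a else 0 := by
    intro b
    simp only [← mul_assoc, ← Finset.sum_mul]
    by_cases hba : b = a
    · subst hba
      have := congrArg (Int.cast (R := R)) (h1 b ha)
      push_cast at this
      rw [this, one_mul, if_pos rfl]
    · rw [if_neg hba]
      by_cases hb : b ∈ σ
      · have := congrArg (Int.cast (R := R)) (h0 a ha b hb hba)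
        push_cast at this
        rw [this, zero_mul]
      · rw [hσ b hb, mul_zero]
  simp only [← hy, Finset.mul_sum]
  rw [Finset.sum_comm]
  simp [h]

theorem HasIntegralDual.linearIndepOn {σ : Finset ι} (h : HasIntegralDual M σ) :
    LinearIndepOn ℝ (realColumn M) (σ : Set ι) := by
  classical
  obtain ⟨χ, h1, h0⟩ := h
  rw [linearIndepOn_finset_iff]
  intro f hf a ha
  have h := dual_apply_eq h1 h0 (k := fun b => if b ∈ σ then f b else 0) (y := (0 : Fin d → ℝ))
    (fun b hb => if_neg hb) (fun r => ?_) ha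
  · simpa [ha] using h.symm
  · have := congrFun hf r
    simp only [Finset.sum_apply, Pi.smul_apply, smul_eq_mul, realColumn] at this
    simp only [mul_ite, mul_zero, Finset.sum_ite_mem, Finset.univ_inter]
    rw [← this]
    exact Finset.sum_congr rfl fun b _ => mul_comm _ _

/-- Extending to a basis makes `posCone M σ` a face of a basis cone, that is, one of the sets
intersected in `chamberCell`. -/
theorem HasIntegralDual.exists_isColumnBasis {σ : Finset ι} (h : HasIntegralDual M σ)
    (hspan : Submodule.span ℝ (Set.range (realColumn M)) = ⊤) :
    ∃ τ, σ ⊆ τ ∧ IsColumnBasis M τ := by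
  classical
  have hli := h.linearIndepOn
  set T := hli.extend (Set.subset_univ _) with hT
  have hTli := hli.linearIndepOn_extend (Set.subset_univ _)
  have hTspan : Submodule.span ℝ (realColumn M '' T) = ⊤ := by
    rw [hli.span_image_extend_eq_span_image, Set.image_univ, hspan]
  have hcoe : ((T.toFinset : Finset ι) : Set ι) = T := Set.coe_toFinset T
  refine ⟨T.toFinset, ?_, ?_, ?_⟩
  · rw [← Finset.coe_subset, hcoe]
    exact hli.subset_extend _
  · have hc := finrank_span_eq_card (R := ℝ) hTli.linearIndependent
    rw [← Set.image_eq_range, hTspan, finrank_top, Module.finrank_fin_fun] at hc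
    rw [Set.toFinset_card, ← hc]
  · rw [Matrix.rank_eq_finrank_span_cols]
    have : Set.range ((M.map (Int.cast : ℤ → ℝ)).submatrix id
        (Subtype.val : {a // a ∈ T.toFinset} → ι)).col = realColumn M '' T := by
      ext z
      constructor
      · rintro ⟨⟨a, ha⟩, rfl⟩
        exact ⟨a, Set.mem_toFinset.1 ha, rfl⟩
      · rintro ⟨a, ha, rfl⟩
        exact ⟨⟨a, Set.mem_toFinset.2 ha⟩, rfl⟩
    rw [this, hTspan, finrank_top, Module.finrank_fin_fun]

theorem IsPosCombination.chamberCell_subset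
    (hspan : Submodule.span ℝ (Set.range (realColumn M)) = ⊤) {σ : Finset ι}
    (hσ : HasIntegralDual M σ) {x : Fin d → ℝ} (hx : IsPosCombination M σ x) :
    chamberCell M x ⊆ posCone M σ := fun _ hy => by
  obtain ⟨τ, hτ, hbasis⟩ := hσ.exists_isColumnBasis hspan
  exact hy τ σ hbasis hτ hx.mem_posCone

/-- The segment from `x` to `y` continues past `y` inside the cone. A coordinate positive at `x` and
zero at `y` would be negative beyond `y`. -/
theorem IsPosCombination.of_mem_intrinsicInterior
    (hspan : Submodule.span ℝ (Set.range (realColumn M)) = ⊤) {σ : Finset ι}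
    (hσ : HasIntegralDual M σ) {x y : Fin d → ℝ} (hx : IsPosCombination M σ x)
    (hy : y ∈ intrinsicInterior ℝ (chamberCell M x)) : IsPosCombination M σ y := by
  have hsub := hx.chamberCell_subset hspan hσ
  obtain ⟨ε, hε, hz⟩ :=
    exists_pos_add_smul_sub_mem_of_mem_intrinsicInterior (mem_chamberCell_self x) hy
  obtain ⟨k, hk, hkσ, hkx⟩ := hx
  obtain ⟨l, hl, hlσ, hly⟩ := mem_posCone_iff.1 (hsub (intrinsicInterior_subset hy))
  obtain ⟨w, hw, hwσ, hwz⟩ := mem_posCone_iff.1 (hsub hz)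
  obtain ⟨χ, h1, h0⟩ := hσ
  refine ⟨l, fun a ha => ?_, hlσ, hly⟩
  have e1 := dual_apply_eq h1 h0 hkσ hkx ha
  have e2 := dual_apply_eq h1 h0 hlσ hly ha
  have e3 := dual_apply_eq h1 h0 hwσ hwz ha
  have e4 : w a = l a + ε * (l a - k a) := by
    rw [← e1, ← e2, ← e3, ← Finset.sum_sub_distrib, Finset.mul_sum, ← Finset.sum_add_distrib]
    refine Finset.sum_congr rfl fun r _ => ?_
    simp only [Pi.add_apply, Pi.smul_apply, Pi.sub_apply, smul_eq_mul]
    ring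
  have h5 := hw a
  have h6 := mul_pos hε (hk a ha)
  by_contra hneg
  have h7 := mul_nonneg hε.le (sub_nonneg.2 (not_lt.1 hneg))
  nlinarith

/-- The indices at which a vector of coefficients does not vanish. -/
noncomputable def coeffSupport (k : ι → ℝ) : Finset ι := by
  classical exact Finset.univ.filter fun a => k a ≠ 0

theorem mem_coeffSupport {k : ι → ℝ} {a : ι} : a ∈ coeffSupport k ↔ k a ≠ 0 := by
  simp [coeffSupport]

/-- A version of Carathéodory's theorem: every nonnegative combination of columns is one with an
independent support and no larger cost. -/
theorem exists_hasIntegralDual_cost_le (hM : IsPositive M)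
    (hdich : ∀ σ, HasIntegralDual M σ ∨ HasSignedRelation M σ) (w k : ι → ℝ) (hk : ∀ a, 0 ≤ k a) :
    ∃ l : ι → ℝ, (∀ a, 0 ≤ l a) ∧ HasIntegralDual M (coeffSupport l) ∧
      (∀ r, ∑ a, (M r a : ℝ) * l a = ∑ a, (M r a : ℝ) * k a) ∧
      ∑ a, w a * l a ≤ ∑ a, w a * k a := by
  classical
  obtain ⟨S, hS⟩ : ∃ S, coeffSupport k = S := ⟨_, rfl⟩
  induction S using Finset.strongInduction generalizing k with
  | H S IH =>
  rcases hdich S with hdual | hsr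
  · exact ⟨k, hk, hS ▸ hdual, fun _ => rfl, le_rfl⟩
  obtain ⟨A, B, hA, hB, hAB, hBne, hrel, hcost⟩ := hsr.exists_cost_le hM w
  -- Mass `k b` is moved from `B` to the cheaper side `A`. Minimality of `k b` keeps the
  -- coefficients nonnegative, and `b` leaves the support.
  obtain ⟨b, hb, hmin⟩ := Finset.exists_min_image B k hBne
  have hsum : ∀ u : ι → ℝ, ∑ a, u a * (k a + k b * ((if a ∈ A then 1 else 0) -
      (if a ∈ B then 1 else 0))) =
      ∑ a, u a * k a + k b * (∑ a ∈ A, u a - ∑ a ∈ B, u a) := by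
    intro u
    have h1 : ∀ T : Finset ι, ∑ a ∈ T, u a = ∑ a, u a * (if a ∈ T then 1 else 0) := by
      intro T; simp
    rw [h1, h1, ← Finset.sum_sub_distrib, Finset.mul_sum, ← Finset.sum_add_distrib]
    exact Finset.sum_congr rfl fun a _ => by ring
  set k' : ι → ℝ := fun a => k a + k b * ((if a ∈ A then 1 else 0) - (if a ∈ B then 1 else 0))
    with hk'
  have hk'0 : ∀ a, 0 ≤ k' a := by
    intro a
    have hkb := hk b
    have hka := hk a
    by_cases haB : a ∈ B
    · have := hmin a haB
      simp only [hk', haB, Finset.disjoint_right.1 hAB haB, if_true, if_false]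
      linarith
    · by_cases haA : a ∈ A <;> simp only [hk', haB, haA, if_true, if_false] <;> linarith
  have hss : coeffSupport k' ⊂ S := by
    rw [Finset.ssubset_iff_of_subset]
    · refine ⟨b, hB hb, ?_⟩
      rw [mem_coeffSupport, not_not]
      simp [hk', hb, Finset.disjoint_right.1 hAB hb]
    · intro a ha
      by_contra haS
      have h0 : k a = 0 := by
        by_contra h0
        exact haS (hS ▸ mem_coeffSupport.2 h0)
      refine mem_coeffSupport.1 ha ?_
      have h1 : a ∉ A := fun h => haS (hA h)
      have h2 : a ∉ B := fun h => haS (hB h)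
      simp [hk', h0, h1, h2]
  obtain ⟨l, hl, hdual, heq, hle⟩ := IH _ hss k' hk'0 rfl
  refine ⟨l, hl, hdual, fun r => ?_, ?_⟩
  · rw [heq r, hsum fun a => (M r a : ℝ)]
    have := congrArg (Int.cast (R := ℝ)) (hrel r)
    push_cast at this
    rw [this, sub_self, mul_zero, add_zero]
  · refine hle.trans ?_
    rw [hsum w]
    nlinarith [hk b]

theorem exists_pos_mul_le {k l : ι → ℝ} (hk : ∀ a, 0 ≤ k a) (hl : ∀ a, 0 ≤ l a)
    (h : ∀ a, k a = 0 → l a = 0) : ∃ ε : ℝ, 0 < ε ∧ ∀ a, ε * l a ≤ k a := by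
  have hs : ∀ a, 0 ≤ l a / k a := fun a => div_nonneg (hl a) (hk a)
  have hS : 0 ≤ ∑ a, l a / k a := Finset.sum_nonneg fun a _ => hs a
  -- Every ratio is at most the sum of all of them. Where `k a = 0` the ratio is zero by convention
  -- and `l a = 0` by `h`.
  refine ⟨(1 + ∑ a, l a / k a)⁻¹, by positivity, fun a => ?_⟩
  rw [inv_mul_le_iff₀ (by positivity)]
  rcases (hk a).eq_or_lt with h0 | hpos
  · rw [h a h0.symm, ← h0, mul_zero]
  · have h1 : l a / k a ≤ ∑ a, l a / k a :=
      Finset.single_le_sum (f := fun a => l a / k a) (fun a _ => hs a) (Finset.mem_univ a)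
    rw [← div_le_iff₀ hpos]
    linarith

theorem isPosCombination_coeffSupport {k : ι → ℝ} (hk : ∀ a, 0 ≤ k a) {y : Fin d → ℝ}
    (hy : ∀ r, ∑ a, (M r a : ℝ) * k a = y r) : IsPosCombination M (coeffSupport k) y :=
  ⟨k, fun a ha => (hk a).lt_of_ne' (mem_coeffSupport.1 ha),
    fun a ha => by rwa [mem_coeffSupport, not_not] at ha, hy⟩

/-- A simplicial cone whose relative interior meets the relative interior of the cell through `x`
has `x` in its relative interior. -/
theorem IsPosCombination.center (hM : IsPositive M)
    (hdich : ∀ σ, HasIntegralDual M σ ∨ HasSignedRelation M σ)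
    (hspan : Submodule.span ℝ (Set.range (realColumn M)) = ⊤) {ρ : Finset ι}
    (hρ : HasIntegralDual M ρ) {x y : Fin d → ℝ} (hx : x ∈ posCone M Finset.univ)
    (hy : y ∈ intrinsicInterior ℝ (chamberCell M x)) (hyρ : IsPosCombination M ρ y) :
    IsPosCombination M ρ x := by
  classical
  -- The cost is the mass outside `ρ`. `K` holds the independent representations of `x`, each
  -- determined by its support, hence finitely many.
  set w : ι → ℝ := fun a => if a ∈ ρ then 0 else 1 with hw
  set K : Set (ι → ℝ) := {k | (∀ a, 0 ≤ k a) ∧ HasIntegralDual M (coeffSupport k) ∧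
    ∀ r, ∑ a, (M r a : ℝ) * k a = x r} with hK
  have hKfin : K.Finite := by
    refine Set.Finite.of_injOn (f := coeffSupport) (t := Set.univ) (fun _ _ => Set.mem_univ _) ?_
      Set.finite_univ
    rintro k ⟨-, hkd, hkx⟩ l ⟨-, -, hlx⟩ hkl
    obtain ⟨χ, h1, h0⟩ := hkd
    have hks : ∀ a ∉ coeffSupport k, k a = 0 := fun a ha => by
      rwa [mem_coeffSupport, not_not] at ha
    have hls : ∀ a ∉ coeffSupport k, l a = 0 := fun a ha => by
      rwa [hkl, mem_coeffSupport, not_not] at ha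
    funext a
    by_cases ha : a ∈ coeffSupport k
    · rw [← dual_apply_eq h1 h0 hks hkx ha, dual_apply_eq h1 h0 hls hlx ha]
    · rw [hks a ha, hls a ha]
  have hKne : K.Nonempty := by
    obtain ⟨k, hk, -, hkx⟩ := mem_posCone_iff.1 hx
    obtain ⟨l, hl, hld, hlx, -⟩ := exists_hasIntegralDual_cost_le hM hdich w k hk
    exact ⟨l, hl, hld, fun r => (hlx r).trans (hkx r)⟩
  obtain ⟨k, ⟨hk, hkd, hkx⟩, hmin⟩ := Set.exists_min_image K (fun k => ∑ a, w a * k a) hKfin hKne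
  have hxκ := isPosCombination_coeffSupport hk hkx
  obtain ⟨l, hl, hls, hly⟩ := hxκ.of_mem_intrinsicInterior hspan hkd hy
  obtain ⟨s, hs, hsρ, hsy⟩ := hyρ
  have hl0 : ∀ a, 0 ≤ l a := fun a => by
    by_cases ha : a ∈ coeffSupport k
    exacts [(hl a ha).le, (hls a ha).ge]
  have hs0 : ∀ a, 0 ≤ s a := fun a => by
    by_cases ha : a ∈ ρ
    exacts [(hs a ha).le, (hsρ a ha).ge]
  -- Exchange argument: `l` and `s` both represent `y`, and `s` costs nothing. Replacing `ε l` by `ε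
  -- s` inside `k` still represents `x`, more cheaply if `l` has mass outside `ρ`; reducing to an
  -- independent support contradicts the minimality of `k`.
  have hsub : coeffSupport k ⊆ ρ := by
    intro b hb
    by_contra hbρ
    obtain ⟨ε, hε, hεle⟩ := exists_pos_mul_le hk hl0 fun a ha =>
      hls a (by rw [mem_coeffSupport, not_not]; exact ha)
    obtain ⟨l', hl', hl'd, hl'x, hl'c⟩ := exists_hasIntegralDual_cost_le hM hdich w
      (fun a => k a - ε * l a + ε * s a)
      (fun a => add_nonneg (sub_nonneg.2 (hεle a)) (mul_nonneg hε.le (hs0 a)))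
    have hexp : ∀ u : ι → ℝ, ∑ a, u a * (k a - ε * l a + ε * s a) =
        ∑ a, u a * k a - ε * ∑ a, u a * l a + ε * ∑ a, u a * s a := by
      intro u
      rw [Finset.mul_sum, Finset.mul_sum, ← Finset.sum_sub_distrib, ← Finset.sum_add_distrib]
      exact Finset.sum_congr rfl fun a _ => by ring
    have hmem : l' ∈ K := ⟨hl', hl'd, fun r => by
      rw [hl'x r, hexp, hkx, hly, hsy]; ring⟩
    have h1 := (hmin l' hmem).trans hl'c
    rw [hexp] at h1
    have h2 : ∑ a, w a * s a = 0 := Finset.sum_eq_zero fun a _ => by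
      by_cases ha : a ∈ ρ
      · simp [hw, ha]
      · rw [hsρ a ha, mul_zero]
    have h3 : 0 < ∑ a, w a * l a := by
      refine Finset.sum_pos' (fun a _ => mul_nonneg ?_ (hl0 a)) ⟨b, Finset.mem_univ b, ?_⟩
      · simp only [hw]; split_ifs <;> norm_num
      · simp only [hw, if_neg hbρ, one_mul]
        exact hl b hb
    have := mul_pos hε h3
    rw [h2, mul_zero] at h1
    linarith
  -- Within `ρ` the coefficients of `y` are unique, so `l` and `s` have the same support.
  have heq : coeffSupport k = ρ := by
    refine Finset.Subset.antisymm hsub fun a ha => ?_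
    by_contra hak
    obtain ⟨χ, h1, h0⟩ := hρ
    have e1 := dual_apply_eq h1 h0 hsρ hsy ha
    have e2 := dual_apply_eq h1 h0 (fun b hb => hls b fun h => hb (hsub h)) hly ha
    have := hs a ha
    rw [← e1, e2, hls a hak] at this
    exact lt_irrefl _ this
  exact heq ▸ hxκ

/-- The relative interior of a simplicial cone contains the relative interior of a cell if it meets
it. -/
theorem IsPosCombination.of_cell (hM : IsPositive M)
    (hdich : ∀ σ, HasIntegralDual M σ ∨ HasSignedRelation M σ)
    (hspan : Submodule.span ℝ (Set.range (realColumn M)) = ⊤) {ρ : Finset ι}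
    (hρ : HasIntegralDual M ρ) {x y z : Fin d → ℝ} (hx : x ∈ posCone M Finset.univ)
    (hy : y ∈ intrinsicInterior ℝ (chamberCell M x))
    (hz : z ∈ intrinsicInterior ℝ (chamberCell M x)) (hyρ : IsPosCombination M ρ y) :
    IsPosCombination M ρ z :=
  (hyρ.center hM hdich hspan hρ hx hy).of_mem_intrinsicInterior hspan hρ hz

end Cones

/-! ### Polynomiality of fibre sums on cells -/

/-- This is the binomial of k - 1 over m - 1. At `k = 0` the right side is (-1)^(m-1) and not 0,
which is why only relative interiors of cones are covered. -/
theorem compositionCount_eq_prod {m k : ℕ} (hm : 0 < m) (hk : 0 < k) :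
    compositionCount m k =
      ((m - 1).factorial : ℚ)⁻¹ * ∏ i ∈ Finset.range (m - 1), ((k : ℚ) - (i + 1)) := by
  obtain ⟨m, rfl⟩ := Nat.exists_eq_succ_of_ne_zero hm.ne'
  obtain ⟨k, rfl⟩ := Nat.exists_eq_succ_of_ne_zero hk.ne'
  have h1 := descPochhammer_eval_eq_prod_range m (k : ℚ)
  rw [descPochhammer_eval_eq_descFactorial, Nat.descFactorial_eq_factorial_mul_choose] at h1
  have h2 : (m.factorial : ℚ) ≠ 0 := by positivity
  simp only [Nat.succ_eq_add_one, compositionCount, Nat.add_sub_cancel]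
  rw [eq_inv_mul_iff_mul_eq₀ h2]
  push_cast at h1 ⊢
  rw [h1]
  exact Finset.prod_congr rfl fun i _ => by ring

section CellPolynomials

variable {d : ℕ} {ι : Type} [Fintype ι] {M : Matrix (Fin d) ι ℤ}

theorem multSupport_eq_of_prod_ne_zero {m k : ι → ℕ}
    (h : ∏ a, compositionCount (m a) (k a) ≠ 0) : multSupport k = multSupport m := by
  ext a
  rw [mem_multSupport, mem_multSupport]
  exact (pos_iff_pos_of_compositionCount_ne_zero (Finset.prod_ne_zero_iff.1 h a (Finset.mem_univ a))).symm

theorem isPosCombination_of_mem_natFiber {v : Fin d → ℤ} {k : ι → ℕ} (hk : k ∈ natFiber M v) :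
    IsPosCombination M (multSupport k) (fun r => (v r : ℝ)) := by
  refine ⟨fun a => k a, fun a ha => ?_, fun a ha => ?_, fun r => ?_⟩
  · exact Nat.cast_pos.2 (mem_multSupport.1 ha)
  · rw [mem_multSupport, not_lt, Nat.le_zero] at ha
    exact Nat.cast_eq_zero.2 ha
  · have := congrArg (Int.cast (R := ℝ)) (mem_natFiber.1 hk r)
    push_cast at this
    exact this

/-- The polynomial that `fiberSum m` agrees with on the cone of its support. -/
noncomputable def dualPolynomial (χ : ι → Fin d → ℤ) (m : ι → ℕ) : MvPolynomial (Fin d) ℚ :=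
  ∏ a ∈ multSupport m, (MvPolynomial.C ((m a - 1).factorial : ℚ)⁻¹ *
    ∏ i ∈ Finset.range (m a - 1),
      (∑ r, MvPolynomial.C (χ a r : ℚ) * MvPolynomial.X r - MvPolynomial.C ((i : ℚ) + 1)))

theorem totalDegree_dualPolynomial_add_card_le (χ : ι → Fin d → ℤ) (m : ι → ℕ) :
    (dualPolynomial χ m).totalDegree + (multSupport m).card ≤ ∑ a, m a := by
  have h1 : ∀ (a : ι) (i : ℕ), (∑ r, MvPolynomial.C (χ a r : ℚ) * MvPolynomial.X r -
      MvPolynomial.C ((i : ℚ) + 1) : MvPolynomial (Fin d) ℚ).totalDegree ≤ 1 := by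
    intro a i
    refine (MvPolynomial.totalDegree_sub _ _).trans (max_le ?_ ?_)
    · refine MvPolynomial.totalDegree_finsetSum_le fun r _ => ?_
      refine (MvPolynomial.totalDegree_mul _ _).trans ?_
      rw [MvPolynomial.totalDegree_C, MvPolynomial.totalDegree_X]
    · rw [MvPolynomial.totalDegree_C]
      exact Nat.zero_le _
  have h2 : (dualPolynomial χ m).totalDegree ≤ ∑ a ∈ multSupport m, (m a - 1) := by
    refine (MvPolynomial.totalDegree_finsetProd _ _).trans (Finset.sum_le_sum fun a _ => ?_)
    refine (MvPolynomial.totalDegree_mul _ _).trans ?_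
    rw [MvPolynomial.totalDegree_C, zero_add]
    refine (MvPolynomial.totalDegree_finsetProd _ _).trans ?_
    refine (Finset.sum_le_sum fun i _ => h1 a i).trans ?_
    simp
  refine (Nat.add_le_add_right h2 _).trans ?_
  rw [Finset.card_eq_sum_ones, ← Finset.sum_add_distrib]
  refine le_trans (le_of_eq (Finset.sum_congr rfl fun a ha => ?_))
    (Finset.sum_le_sum_of_subset (Finset.subset_univ (multSupport m)))
  have := mem_multSupport.1 ha
  omega

variable [DecidableEq ι]

/-- Only one point of the fibre has the support of `m`: its coordinates are the functionals `χ a` at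
`v`, which are integers because `χ` is integral. -/
theorem fiberSum_eq_eval_dualPolynomial (hM : IsPositive M) {m : ι → ℕ} {χ : ι → Fin d → ℤ}
    (h1 : ∀ a ∈ multSupport m, ∑ r, χ a r * M r a = 1)
    (h0 : ∀ a ∈ multSupport m, ∀ b ∈ multSupport m, b ≠ a → ∑ r, χ a r * M r b = 0)
    {v : Fin d → ℤ} (hv : IsPosCombination M (multSupport m) (fun r => (v r : ℝ))) :
    fiberSum hM m v = MvPolynomial.eval (fun r => (v r : ℚ)) (dualPolynomial χ m) := by
  obtain ⟨k, hk, hkσ, hkv⟩ := hv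
  set z : ι → ℤ := fun a => if a ∈ multSupport m then ∑ r, χ a r * v r else 0 with hz
  have hkz : ∀ a, k a = z a := by
    intro a
    by_cases ha : a ∈ multSupport m
    · rw [← dual_apply_eq h1 h0 hkσ hkv ha]
      simp [hz, ha]
    · simp [hz, ha, hkσ a ha]
  have hzpos : ∀ a ∈ multSupport m, 0 < z a := fun a ha => by
    have := hk a ha
    rw [hkz a] at this
    exact_mod_cast this
  have hz0 : ∀ a, 0 ≤ z a := fun a => by
    by_cases ha : a ∈ multSupport m
    · exact (hzpos a ha).le
    · simp [hz, ha]
  have hzn : ∀ a, ((z a).toNat : ℤ) = z a := fun a => Int.toNat_of_nonneg (hz0 a)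
  have hfib : (fun a => (z a).toNat) ∈ natFiber M v := by
    rw [mem_natFiber]
    intro r
    simp only [hzn]
    have := hkv r
    simp only [hkz] at this
    exact_mod_cast this
  rw [fiberSum, Finset.sum_eq_single (fun a => (z a).toNat)]
  · rw [dualPolynomial, MvPolynomial.eval_prod,
      ← Finset.prod_subset (Finset.subset_univ (multSupport m))]
    · refine Finset.prod_congr rfl fun a ha => ?_
      have hpos := hzpos a ha
      rw [compositionCount_eq_prod (mem_multSupport.1 ha) (Int.pos_iff_toNat_pos.1 hpos)]
      rw [map_mul, MvPolynomial.eval_C, map_prod]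
      congr 1
      refine Finset.prod_congr rfl fun i _ => ?_
      have hcast : (((z a).toNat : ℕ) : ℚ) = ∑ r, (χ a r : ℚ) * (v r : ℚ) := by
        have h2 : (((z a).toNat : ℤ) : ℚ) = ((∑ r, χ a r * v r : ℤ) : ℚ) := by
          rw [hzn, hz]
          simp only [if_pos ha]
        push_cast at h2
        exact_mod_cast h2
      rw [hcast]
      simp
    · intro a _ ha
      have hm0 : m a = 0 := by rwa [mem_multSupport, not_lt, Nat.le_zero] at ha
      simp [hz, ha, hm0, compositionCount]
  · intro l hl hne
    by_contra hprod
    refine hne (funext fun a => ?_)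
    rw [Set.Finite.mem_toFinset, mem_natFiber] at hl
    have hsupp := multSupport_eq_of_prod_ne_zero hprod
    have hl0 : ∀ a ∉ multSupport m, l a = 0 := fun a ha => by
      rwa [← hsupp, mem_multSupport, not_lt, Nat.le_zero] at ha
    zify
    rw [hzn]
    by_cases ha : a ∈ multSupport m
    · have := dual_apply_eq (R := ℤ) h1 h0 (k := fun a => (l a : ℤ)) (y := v)
        (fun a ha => by simp [hl0 a ha]) (fun r => by simpa using hl r) ha
      simp only [hz, if_pos ha]
      rw [← this]
      simp
    · simp [hz, ha, hl0 a ha]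
  · intro h
    exact absurd ((Set.Finite.mem_toFinset _).2 hfib) h

/-- The functions in the span of the independent fiber sums are polynomial on the relative interior
of every cell. -/
theorem exists_polynomial_of_mem_independentFiberSums (hM : IsPositive M)
    (hdich : ∀ σ, HasIntegralDual M σ ∨ HasSignedRelation M σ)
    (hspan : Submodule.span ℝ (Set.range (realColumn M)) = ⊤) {x : Fin d → ℝ}
    (hx : x ∈ posCone M Finset.univ) {f : (Fin d → ℤ) → ℚ} (hf : f ∈ independentFiberSums hM) :
    ∃ P : MvPolynomial (Fin d) ℚ, P.totalDegree ≤ Fintype.card ι - d ∧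
      ∀ v : Fin d → ℤ, (fun r => (v r : ℝ)) ∈ intrinsicInterior ℝ (chamberCell M x) →
        f v = MvPolynomial.eval (fun r => (v r : ℚ)) P := by
  induction hf using Submodule.span_induction with
  | mem f hf =>
    obtain ⟨m, hdual, hdeg, rfl⟩ := hf
    -- By `of_cell`, one lattice point of the open cell in the open cone forces all of them to lie
    -- there. If there is none, every summand vanishes on the cell.
    by_cases hex : ∃ v : Fin d → ℤ,
        (fun r => (v r : ℝ)) ∈ intrinsicInterior ℝ (chamberCell M x) ∧
        IsPosCombination M (multSupport m) (fun r => (v r : ℝ))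
    · obtain ⟨v₀, hv₀, hpos⟩ := hex
      obtain ⟨χ, h1, h0⟩ := id hdual
      refine ⟨dualPolynomial χ m, ?_, fun v hv => fiberSum_eq_eval_dualPolynomial hM h1 h0
        (hpos.of_cell hM hdich hspan hdual hx hv₀ hv)⟩
      have := totalDegree_dualPolynomial_add_card_le χ m
      omega
    · refine ⟨0, by simp, fun v hv => ?_⟩
      rw [map_zero, fiberSum]
      refine Finset.sum_eq_zero fun k hk => ?_
      by_contra hne
      rw [Set.Finite.mem_toFinset] at hk
      exact hex ⟨v, hv, multSupport_eq_of_prod_ne_zero hne ▸ isPosCombination_of_mem_natFiber hk⟩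
  | zero => exact ⟨0, by simp, fun v _ => by simp⟩
  | add f g _ _ hf hg =>
    obtain ⟨P, hP, hPv⟩ := hf
    obtain ⟨Q, hQ, hQv⟩ := hg
    exact ⟨P + Q, (MvPolynomial.totalDegree_add _ _).trans (max_le hP hQ), fun v hv => by
      rw [Pi.add_apply, hPv v hv, hQv v hv, map_add]⟩
  | smul c f _ hf =>
    obtain ⟨P, hP, hPv⟩ := hf
    exact ⟨c • P, (MvPolynomial.totalDegree_smul_le _ _).trans hP, fun v hv => by
      rw [Pi.smul_apply, hPv v hv, MvPolynomial.smul_eval, smul_eq_mul]⟩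

theorem multSupport_finsetIndicator (S : Finset ι) : multSupport (finsetIndicator S) = S := by
  ext a
  rw [mem_multSupport, finsetIndicator]
  split_ifs with h <;> simp [h]

/-- The required bound |S| + d ≤ |ι| + rank(S) holds because adding the columns outside S raises the
rank to d. -/
theorem fiberSum_finsetIndicator_mem (hM : IsPositive M)
    (hdich : ∀ σ, HasIntegralDual M σ ∨ HasSignedRelation M σ)
    (hspan : Submodule.span ℝ (Set.range (realColumn M)) = ⊤) (S : Finset ι) :
    fiberSum hM (finsetIndicator S) ∈ independentFiberSums hM := by
  refine fiberSum_mem_independentFiberSums hM hdich _ ?_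
  rw [multSupport_finsetIndicator]
  have h1 : columnRank M Finset.univ = d := by
    rw [columnRank, Finset.coe_univ, Set.image_univ, hspan, finrank_top, Module.finrank_fin_fun]
  have h2 := columnRank_le_sdiff_add_card (M := M) Finset.univ Sᶜ
  rw [h1, ← Finset.compl_eq_univ_sdiff, compl_compl] at h2
  have h3 := Finset.card_add_card_compl S
  have h4 : ∑ a, finsetIndicator S a = S.card := by simp [finsetIndicator]
  omega

theorem prod_compositionCount_finsetIndicator (S : Finset ι) (k : ι → ℕ) :
    ∏ a, compositionCount (finsetIndicator S a) (k a) = if multSupport k = S then 1 else 0 := by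
  split_ifs with h
  · refine Finset.prod_eq_one fun a _ => ?_
    subst h
    simp only [finsetIndicator, mem_multSupport]
    rcases Nat.eq_zero_or_pos (k a) with h0 | h0
    · simp [h0, compositionCount]
    · obtain ⟨l, hl⟩ := Nat.exists_eq_succ_of_ne_zero h0.ne'
      simp [hl, compositionCount]
  · by_contra hne
    exact h ((multSupport_eq_of_prod_ne_zero hne).trans (multSupport_finsetIndicator S))

theorem fiberSum_finsetIndicator (hM : IsPositive M) (S : Finset ι) (v : Fin d → ℤ) :
    fiberSum hM (finsetIndicator S) v =
      (((hM.natFiber_finite v).toFinset.filter fun k => multSupport k = S).card : ℚ) := by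
  simp only [fiberSum, prod_compositionCount_finsetIndicator]
  rw [Finset.sum_boole]

end CellPolynomials

/-! ### Growth along rays and lattice points in open cones -/

section Growth

open Filter Topology Pointwise

/-- A polynomial that grows at least as fast as the `D`-th power along a ray through the origin has
total degree at least `D`. -/
theorem le_totalDegree_of_pow_le_eval {d D : ℕ} (Q : MvPolynomial (Fin d) ℚ) (u : Fin d → ℚ)
    (h : ∀ s : ℕ, 1 ≤ s → (s : ℚ) ^ D ≤ MvPolynomial.eval (fun r => (s : ℚ) * u r) Q) :
    D ≤ Q.totalDegree := by
  by_contra! hlt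
  set R : ℚ[X] := MvPolynomial.aeval (fun r => Polynomial.X * Polynomial.C (u r)) Q with hR
  have hev : ∀ s : ℚ, R.eval s = MvPolynomial.eval (fun r => s * u r) Q := by
    intro s
    rw [hR, MvPolynomial.aeval_def, ← Polynomial.coe_evalRingHom, MvPolynomial.eval₂_comp_left]
    rw [MvPolynomial.eval, MvPolynomial.coe_eval₂Hom]
    congr 1
    · exact RingHom.ext fun x => by simp
    · funext r
      simp only [Function.comp_apply, Polynomial.coe_evalRingHom, Polynomial.eval_mul,
        Polynomial.eval_X, Polynomial.eval_C]
  have hdeg : R.natDegree < D := by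
    refine lt_of_le_of_lt (MvPolynomial.aeval_natDegree_le Q le_rfl _ (n := 1) fun r => ?_)
      (by simpa using hlt)
    refine Polynomial.natDegree_mul_le.trans ?_
    simp
  have hlim := Polynomial.div_tendsto_atTop_zero_of_degree_lt R (Polynomial.X ^ D : ℚ[X]) (by
    rw [Polynomial.degree_X_pow]
    exact (Polynomial.degree_le_natDegree).trans_lt (by exact_mod_cast hdeg))
  have hlim' := hlim.comp (tendsto_natCast_atTop_atTop (R := ℚ))
  obtain ⟨s, hs, hs1⟩ := ((hlim'.eventually (gt_mem_nhds one_pos)).and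
    (eventually_ge_atTop 1)).exists
  have hspos : (0 : ℚ) < (s : ℚ) ^ D := by positivity
  simp only [Function.comp_apply, Polynomial.eval_pow, Polynomial.eval_X, hev] at hs
  rw [div_lt_one hspos] at hs
  exact absurd (h s hs1) (not_le.2 hs)

/-- An interior point is approximated by a rational one with denominator `N`, and the denominator is
cleared by scaling. -/
theorem exists_int_mem_interior_of_cone {d : ℕ} {C : Set (Fin d → ℝ)}
    (hC : ∀ t : ℝ, 0 < t → ∀ y ∈ C, t • y ∈ C) (hne : (interior C).Nonempty) :
    ∃ v : Fin d → ℤ, ∀ t : ℝ, 0 < t → t • (fun r => (v r : ℝ)) ∈ interior C := by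
  have hint : ∀ t : ℝ, 0 < t → ∀ y ∈ interior C, t • y ∈ interior C := by
    intro t ht y hy
    have h1 : t • y ∈ interior (t • C) := by
      rw [interior_smul₀ ht.ne']
      exact Set.smul_mem_smul_set hy
    refine interior_mono ?_ h1
    rintro _ ⟨z, hz, rfl⟩
    exact hC t ht z hz
  obtain ⟨y, hy⟩ := hne
  obtain ⟨δ, hδ, hball⟩ := Metric.isOpen_iff.1 isOpen_interior y hy
  obtain ⟨N, hN⟩ := exists_nat_gt (1 / δ)
  have hNpos : (0 : ℝ) < N := lt_trans (by positivity) hN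
  refine ⟨fun r => ⌊(N : ℝ) * y r⌋, fun t ht => ?_⟩
  have hmem : (fun r => (⌊(N : ℝ) * y r⌋ : ℝ) / N) ∈ interior C := by
    refine hball ?_
    rw [Metric.mem_ball, dist_pi_lt_iff hδ]
    intro r
    have h1 := Int.floor_le ((N : ℝ) * y r)
    have h2 := Int.lt_floor_add_one ((N : ℝ) * y r)
    have h3 : 1 < δ * N := by rwa [div_lt_iff₀' hδ] at hN
    have h4 : y r - δ < ⌊(N : ℝ) * y r⌋ / N := by
      rw [lt_div_iff₀ hNpos]
      nlinarith
    have h5 : (⌊(N : ℝ) * y r⌋ : ℝ) / N < y r + δ := by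
      rw [div_lt_iff₀ hNpos]
      nlinarith
    rw [Real.dist_eq, abs_lt]
    constructor <;> linarith
  have := hint (t * N) (by positivity) _ hmem
  convert this using 1
  funext r
  simp only [Pi.smul_apply, smul_eq_mul]
  field_simp

end Growth

/-! ### Application to type A: lower bounds and assembly -/

section RootMatrix

variable {n : ℕ}

theorem isPositive_rootMatrix : IsPositive (rootMatrix n) :=
  ⟨rootMatrix_nonneg, exists_rootMatrix_pos⟩

theorem span_realColumn_rootMatrix :
    Submodule.span ℝ (Set.range (realColumn (rootMatrix n))) = ⊤ := by
  rw [eq_top_iff]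
  intro y _
  have : y = ∑ s, y s • realColumn (rootMatrix n) (simpleIdx s) := by
    funext r
    simp [realColumn, rootMatrix_simpleIdx]
  rw [this]
  exact Submodule.sum_mem _ fun s _ => Submodule.smul_mem _ _ (Submodule.subset_span ⟨_, rfl⟩)

theorem card_posRootIdx_sub : Fintype.card (PosRootIdx n) - n = n.choose 2 := by
  rw [card_posRootIdx, Nat.choose_succ_succ' n 1, Nat.choose_one_right, Nat.add_sub_cancel_left]

theorem kostantQ_eq_sum (v : Fin n → ℤ) :
    kostantQ n (∑ r, v r • simpleRoot n r) =
      ∑ S : Finset (PosRootIdx n),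
        X ^ S.card * C (fiberSum isPositive_rootMatrix (finsetIndicator S) v) := by
  have hset : (kostantSet_finite n (∑ r, v r • simpleRoot n r)).toFinset =
      (isPositive_rootMatrix.natFiber_finite v).toFinset := by
    ext k
    rw [Set.Finite.mem_toFinset, Set.Finite.mem_toFinset, mem_kostantSet_iff, mem_natFiber]
  rw [kostantQ, hset]
  simp only [fiberSum, prod_compositionCount_finsetIndicator, map_sum, Finset.mul_sum]
  rw [Finset.sum_comm]
  refine Finset.sum_congr rfl fun k _ => ?_
  rw [Finset.sum_eq_single (multSupport k)]
  · rw [if_pos rfl, map_one, mul_one]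
    rfl
  · intro S _ hS
    rw [if_neg hS.symm, map_zero, mul_zero]
  · exact fun h => absurd (Finset.mem_univ _) h

theorem val_fst_lt (a : PosRootIdx n) : (a.1.1 : ℕ) < n := by
  have h1 : (a.1.1 : ℕ) < a.1.2 := a.2
  have h2 := a.1.2.is_lt
  omega

open Classical in
/-- The multiplicities of the positive roots with prescribed values at the roots that are not
simple, and with the values at the simple roots that are needed to reach the vector `v`. -/
noncomputable def completeMultiplicities (v : Fin n → ℤ)
    (u : {a : PosRootIdx n // a ∉ Set.range simpleIdx} → ℕ) (a : PosRootIdx n) : ℕ :=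
  if h : a ∈ Set.range simpleIdx then
    (v ⟨a.1.1, val_fst_lt a⟩ - ∑ b, rootMatrix n ⟨a.1.1, val_fst_lt a⟩ b.1 * (u b : ℤ)).toNat
  else u ⟨a, h⟩

theorem completeMultiplicities_simpleIdx (v : Fin n → ℤ)
    (u : {a : PosRootIdx n // a ∉ Set.range simpleIdx} → ℕ) (r : Fin n) :
    completeMultiplicities v u (simpleIdx r) =
      (v r - ∑ b, rootMatrix n r b.1 * (u b : ℤ)).toNat := by
  rw [completeMultiplicities, dif_pos ⟨r, rfl⟩]
  rfl

theorem completeMultiplicities_of_notMem (v : Fin n → ℤ)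
    (u : {a : PosRootIdx n // a ∉ Set.range simpleIdx} → ℕ) {a : PosRootIdx n}
    (h : a ∉ Set.range simpleIdx) : completeMultiplicities v u a = u ⟨a, h⟩ := by
  rw [completeMultiplicities, dif_neg h]

/-- The simple roots are the unit columns, so they absorb whatever the other roots leave over; by
`h` that remainder is nonnegative and `toNat` is exact. -/
theorem completeMultiplicities_mem_natFiber {v : Fin n → ℤ}
    {u : {a : PosRootIdx n // a ∉ Set.range simpleIdx} → ℕ}
    (h : ∀ r, ∑ b, rootMatrix n r b.1 * (u b : ℤ) ≤ v r) :
    completeMultiplicities v u ∈ natFiber (rootMatrix n) v := by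
  classical
  rw [mem_natFiber]
  intro r
  have h1 : ∀ _ : Fintype {a // a ∈ Set.range (simpleIdx (n := n))},
      ∑ a : {a // a ∈ Set.range (simpleIdx (n := n))},
      rootMatrix n r a * (completeMultiplicities v u a : ℤ) =
      completeMultiplicities v u (simpleIdx r) := by
    intro _
    rw [← (Equiv.ofInjective _ (simpleIdx_injective (n := n))).sum_comp]
    simp [rootMatrix_simpleIdx]
  have h2 : ∑ b : {a // a ∉ Set.range (simpleIdx (n := n))},
      rootMatrix n r b * (completeMultiplicities v u b : ℤ) = ∑ b, rootMatrix n r b.1 * (u b : ℤ) :=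
    Finset.sum_congr rfl fun b _ => by rw [completeMultiplicities_of_notMem v u b.2]
  refine ((Fintype.sum_subtype_add_sum_subtype (fun a => a ∈ Set.range (simpleIdx (n := n)))
    fun a => rootMatrix n r a * (completeMultiplicities v u a : ℤ)).symm.trans
    (congrArg₂ (· + ·) (h1 _) h2)).trans ?_
  simp only [completeMultiplicities_simpleIdx, Int.toNat_of_nonneg (sub_nonneg.2 (h r)),
    sub_add_cancel]

theorem rootMatrix_le_one (r : Fin n) (a : PosRootIdx n) : rootMatrix n r a ≤ 1 := by
  rw [rootMatrix, Matrix.of_apply]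
  split_ifs <;> simp

theorem card_notMem_range_simpleIdx [Fintype {a : PosRootIdx n // a ∉ Set.range simpleIdx}] :
    Fintype.card {a : PosRootIdx n // a ∉ Set.range simpleIdx} = n.choose 2 := by
  classical
  rw [← card_posRootIdx_sub, Fintype.card_subtype_compl]
  congr 1
  exact (Set.card_range_of_injective simpleIdx_injective).trans (Fintype.card_fin n)

/-- A lower bound for the number of decompositions in which every positive root occurs. -/
theorem pow_le_fiberSum {v : Fin n → ℤ} {s : ℕ}
    (hv : ∀ r, (Fintype.card (PosRootIdx n) : ℤ) * s + 1 ≤ v r) :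
    (s : ℚ) ^ n.choose 2 ≤ fiberSum isPositive_rootMatrix (finsetIndicator Finset.univ) v := by
  classical
  rw [fiberSum_finsetIndicator]
  have hcard : s ^ n.choose 2 =
      (Finset.univ : Finset ({a : PosRootIdx n // a ∉ Set.range simpleIdx} → Fin s)).card := by
    rw [Finset.card_univ, Fintype.card_fun, Fintype.card_fin, card_notMem_range_simpleIdx]
  rw [← Nat.cast_pow, Nat.cast_le, hcard]
  -- The inequality is strict so that every simple root also receives a positive multiplicity.
  have hle : ∀ (g : {a : PosRootIdx n // a ∉ Set.range simpleIdx} → Fin s) (r : Fin n),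
      ∑ b, rootMatrix n r b.1 * (((g b : ℕ) + 1 : ℕ) : ℤ) < v r := by
    intro g r
    refine lt_of_le_of_lt ?_ (Int.lt_of_add_one_le (hv r))
    calc ∑ b, rootMatrix n r b.1 * (((g b : ℕ) + 1 : ℕ) : ℤ)
        ≤ ∑ b : {a : PosRootIdx n // a ∉ Set.range simpleIdx}, (s : ℤ) := by
          refine Finset.sum_le_sum fun b _ => ?_
          have h1 := rootMatrix_le_one r b.1
          have h2 : (((g b : ℕ) + 1 : ℕ) : ℤ) ≤ s := by exact_mod_cast (g b).is_lt
          have h3 : (0 : ℤ) ≤ (((g b : ℕ) + 1 : ℕ) : ℤ) := by positivity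
          nlinarith
      _ ≤ (Fintype.card (PosRootIdx n) : ℤ) * s := by
          rw [Finset.sum_const, nsmul_eq_mul]
          refine mul_le_mul_of_nonneg_right ?_ (by positivity)
          exact_mod_cast Fintype.card_subtype_le _
  refine Finset.card_le_card_of_injOn
    (fun g => completeMultiplicities v fun b => (g b : ℕ) + 1) (fun g _ => ?_) ?_
  · rw [Finset.mem_coe, Finset.mem_filter, Set.Finite.mem_toFinset]
    refine ⟨completeMultiplicities_mem_natFiber fun r => (hle g r).le, ?_⟩
    refine Finset.eq_univ_of_forall fun a => mem_multSupport.2 ?_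
    by_cases ha : a ∈ Set.range simpleIdx
    · obtain ⟨r, rfl⟩ := ha
      simp only [completeMultiplicities_simpleIdx]
      have := hle g r
      omega
    · simp only [completeMultiplicities_of_notMem _ _ ha]
      exact Nat.succ_pos _
  · intro g _ g' _ h
    funext b
    have := congrFun h b.1
    simp only [completeMultiplicities_of_notMem _ _ b.2] at this
    exact Fin.ext (Nat.succ_injective this)

theorem smul_mem_posCone {d : ℕ} {ι : Type} [Fintype ι] {M : Matrix (Fin d) ι ℤ} {σ : Finset ι}
    {t : ℝ} (ht : 0 ≤ t) {y : Fin d → ℝ} (hy : y ∈ posCone M σ) : t • y ∈ posCone M σ := by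
  obtain ⟨k, hk, hσ, hky⟩ := mem_posCone_iff.1 hy
  refine mem_posCone_iff.2 ⟨fun a => t * k a, fun a => mul_nonneg ht (hk a),
    fun a ha => mul_eq_zero_of_right t (hσ a ha), fun r => ?_⟩
  rw [Pi.smul_apply, smul_eq_mul, ← hky r, Finset.mul_sum]
  exact Finset.sum_congr rfl fun a _ => by ring

/-- By Carathéodory, `x` lies in the relative interior of an independent cone. That cone contains
the cell and is spanned by nonnegative columns. -/
theorem nonneg_of_mem_chamberCell {x y : Fin n → ℝ}
    (hx : x ∈ posCone (rootMatrix n) Finset.univ) (hy : y ∈ chamberCell (rootMatrix n) x)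
    (r : Fin n) : 0 ≤ y r := by
  obtain ⟨k, hk, -, hkx⟩ := mem_posCone_iff.1 hx
  obtain ⟨l, hl, hld, hlx, -⟩ := exists_hasIntegralDual_cost_le isPositive_rootMatrix
    hasIntegralDual_or_hasSignedRelation 0 k hk
  have hpos := isPosCombination_coeffSupport hl fun r => (hlx r).trans (hkx r)
  obtain ⟨s, hs, -, hsy⟩ :=
    mem_posCone_iff.1 (hpos.chamberCell_subset span_realColumn_rootMatrix hld hy)
  rw [← hsy r]
  exact Finset.sum_nonneg fun a _ => mul_nonneg (Int.cast_nonneg (rootMatrix_nonneg r a)) (hs a)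

theorem pos_of_mem_interior_chamberCell {x y : Fin n → ℝ}
    (hx : x ∈ posCone (rootMatrix n) Finset.univ)
    (hy : y ∈ interior (chamberCell (rootMatrix n) x)) (r : Fin n) : 0 < y r := by
  have h1 : chamberCell (rootMatrix n) x ⊆ Function.eval r ⁻¹' Set.Ici 0 :=
    fun z hz => nonneg_of_mem_chamberCell hx hz r
  have h2 := interior_mono h1 hy
  rw [← (isOpenMap_eval r).preimage_interior_eq_interior_preimage (continuous_apply r),
    interior_Ici] at h2
  exact h2

/-- On a full-dimensional cell, the polynomial that counts the decompositions in which every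
positive root occurs is nonzero and has the largest possible degree. -/
theorem choose_le_totalDegree_of_interior_nonempty {x : Fin n → ℝ}
    (hx : x ∈ posCone (rootMatrix n) Finset.univ)
    (hne : (interior (chamberCell (rootMatrix n) x)).Nonempty) {Q : MvPolynomial (Fin n) ℚ}
    (hQ : ∀ v : Fin n → ℤ,
      (fun r => (v r : ℝ)) ∈ intrinsicInterior ℝ (chamberCell (rootMatrix n) x) →
      fiberSum isPositive_rootMatrix (finsetIndicator Finset.univ) v =
        MvPolynomial.eval (fun r => (v r : ℚ)) Q) :
    n.choose 2 ≤ Q.totalDegree ∧ Q ≠ 0 := by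
  obtain ⟨v, hv⟩ := exists_int_mem_interior_of_cone
    (C := chamberCell (rootMatrix n) x)
    (fun t ht y hy σ ρ hσ hρ hxρ => smul_mem_posCone ht.le (hy σ ρ hσ hρ hxρ)) hne
  have hpos : ∀ r, 1 ≤ v r := fun r => by
    have h := pos_of_mem_interior_chamberCell hx (hv 1 one_pos) r
    rw [one_smul] at h
    exact_mod_cast h
  set N := Fintype.card (PosRootIdx n) with hN
  -- The factor `N + 1` makes each entry at least `s (N + 1) ≥ N s + 1`, as `pow_le_fiberSum`
  -- demands.
  have key : ∀ s : ℕ, 1 ≤ s → (s : ℚ) ^ n.choose 2 ≤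
      MvPolynomial.eval (fun r => (s : ℚ) * (((N : ℚ) + 1) * v r)) Q := by
    intro s hs
    have hs0 : (0 : ℝ) < s := by exact_mod_cast hs
    have h1 := hQ (fun r => s * ((N + 1) * v r)) (interior_subset_intrinsicInterior (by
      convert hv (s * (N + 1)) (by positivity) using 1
      funext r
      simp only [Pi.smul_apply, smul_eq_mul]
      push_cast
      ring))
    have h2 := pow_le_fiberSum (v := fun r => (s : ℤ) * ((N + 1) * v r)) (s := s) fun r => by
      have h3 : (1 : ℤ) ≤ s := by exact_mod_cast hs
      have h4 : (s : ℤ) * (N + 1) * 1 ≤ s * (N + 1) * v r :=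
        mul_le_mul_of_nonneg_left (hpos r) (by positivity)
      nlinarith
    rw [h1] at h2
    push_cast at h2
    exact h2
  refine ⟨le_totalDegree_of_pow_le_eval Q _ key, ?_⟩
  rintro rfl
  have := key 1 le_rfl
  rw [map_zero, Nat.cast_one, one_pow] at this
  exact absurd this (by norm_num)

/-- The polynomial in `q` and `x` with prescribed coefficients, indexed by sets, of powers of `q`. -/
noncomputable def combinePolynomials (Q : Finset (PosRootIdx n) → MvPolynomial (Fin n) ℚ) :
    MvPolynomial (Fin n) ℚ[X] :=
  ∑ S, MvPolynomial.C (X ^ S.card) * MvPolynomial.map C (Q S)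

theorem totalDegree_combinePolynomials_le {Q : Finset (PosRootIdx n) → MvPolynomial (Fin n) ℚ}
    {D : ℕ} (hQ : ∀ S, (Q S).totalDegree ≤ D) : (combinePolynomials Q).totalDegree ≤ D := by
  refine MvPolynomial.totalDegree_finsetSum_le fun S _ => ?_
  refine (MvPolynomial.totalDegree_mul _ _).trans ?_
  rw [MvPolynomial.totalDegree_C, zero_add]
  refine le_trans ?_ (hQ S)
  exact Finset.sup_mono (MvPolynomial.support_map_subset _ _)

theorem coeff_combinePolynomials (Q : Finset (PosRootIdx n) → MvPolynomial (Fin n) ℚ)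
    (m : Fin n →₀ ℕ) :
    (combinePolynomials Q).coeff m = ∑ S, X ^ S.card * C ((Q S).coeff m) := by
  simp only [combinePolynomials, MvPolynomial.coeff_sum, MvPolynomial.coeff_C_mul,
    MvPolynomial.coeff_map]

theorem natDegree_coeff_combinePolynomials_le
    (Q : Finset (PosRootIdx n) → MvPolynomial (Fin n) ℚ) (m : Fin n →₀ ℕ) :
    ((combinePolynomials Q).coeff m).natDegree ≤ (n + 1).choose 2 := by
  rw [coeff_combinePolynomials]
  refine Polynomial.natDegree_sum_le_of_forall_le _ _ fun S _ => ?_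
  refine Polynomial.natDegree_mul_le.trans ?_
  rw [Polynomial.natDegree_X_pow, Polynomial.natDegree_C, add_zero, ← card_posRootIdx]
  exact Finset.card_le_univ S

/-- Only the set of all roots has the maximal cardinality, so no other support can cancel its
contribution. -/
theorem coeff_coeff_combinePolynomials (Q : Finset (PosRootIdx n) → MvPolynomial (Fin n) ℚ)
    (m : Fin n →₀ ℕ) :
    ((combinePolynomials Q).coeff m).coeff ((n + 1).choose 2) = (Q Finset.univ).coeff m := by
  rw [coeff_combinePolynomials, Polynomial.finsetSum_coeff, Finset.sum_eq_single Finset.univ]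
  · rw [Finset.card_univ, card_posRootIdx, Polynomial.coeff_mul_C, Polynomial.coeff_X_pow_self,
      one_mul]
  · intro S _ hS
    rw [Polynomial.coeff_mul_C, Polynomial.coeff_X_pow, if_neg, zero_mul]
    rw [← card_posRootIdx]
    exact fun h => hS ((Finset.card_eq_iff_eq_univ S).1 h.symm)
  · exact fun h => absurd (Finset.mem_univ _) h

theorem totalDegree_univ_le_combinePolynomials
    (Q : Finset (PosRootIdx n) → MvPolynomial (Fin n) ℚ) :
    (Q Finset.univ).totalDegree ≤ (combinePolynomials Q).totalDegree := by
  refine Finset.sup_mono fun m hm => ?_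
  rw [MvPolynomial.mem_support_iff] at hm ⊢
  intro h
  rw [← coeff_coeff_combinePolynomials, h, Polynomial.coeff_zero] at hm
  exact hm rfl

theorem eval_combinePolynomials (Q : Finset (PosRootIdx n) → MvPolynomial (Fin n) ℚ)
    (v : Fin n → ℤ) :
    MvPolynomial.eval (fun r => (v r : ℚ[X])) (combinePolynomials Q) =
      ∑ S, X ^ S.card * C (MvPolynomial.eval (fun r => (v r : ℚ)) (Q S)) := by
  rw [combinePolynomials, map_sum]
  refine Finset.sum_congr rfl fun S _ => ?_
  rw [map_mul, MvPolynomial.eval_C, MvPolynomial.eval_map, MvPolynomial.eval₂_comp]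
  congr 2

end RootMatrix

theorem mainTheorem5 (n : ℕ) (C : Set (Fin n → ℝ)) (hC : C ∈ chamberComplex (rootMatrix n)) :
    ∃ P : MvPolynomial (Fin n) ℚ[X],
      P.totalDegree ≤ n.choose 2 ∧
      (∀ m, (P.coeff m).natDegree ≤ (n + 1).choose 2) ∧
      ((interior C).Nonempty →
        P.totalDegree = n.choose 2 ∧ ∃ m, (P.coeff m).natDegree = (n + 1).choose 2) ∧
      ∀ v : Fin n → ℤ, (fun k => (v k : ℝ)) ∈ intrinsicInterior ℝ C →
        kostantQ n (∑ k, v k • simpleRoot n k) = MvPolynomial.eval (fun k => (v k : ℚ[X])) P := by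
  obtain ⟨x, hx, rfl⟩ := hC
  choose Q hQdeg hQ using fun S => exists_polynomial_of_mem_independentFiberSums
    isPositive_rootMatrix hasIntegralDual_or_hasSignedRelation span_realColumn_rootMatrix hx
    (fiberSum_finsetIndicator_mem isPositive_rootMatrix hasIntegralDual_or_hasSignedRelation
      span_realColumn_rootMatrix S)
  simp only [card_posRootIdx_sub] at hQdeg
  have hle := totalDegree_combinePolynomials_le hQdeg
  refine ⟨combinePolynomials Q, hle, natDegree_coeff_combinePolynomials_le Q, fun hne => ?_,
    fun v hv => ?_⟩
  · obtain ⟨hdeg, h0⟩ := choose_le_totalDegree_of_interior_nonempty hx hne (hQ Finset.univ)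
    refine ⟨le_antisymm hle (hdeg.trans (totalDegree_univ_le_combinePolynomials Q)), ?_⟩
    obtain ⟨m, hm⟩ := MvPolynomial.ne_zero_iff.1 h0
    refine ⟨m, le_antisymm (natDegree_coeff_combinePolynomials_le Q m)
      (Polynomial.le_natDegree_of_ne_zero ?_)⟩
    rwa [coeff_coeff_combinePolynomials]
  · rw [kostantQ_eq_sum, eval_combinePolynomials]
    exact Finset.sum_congr rfl fun S _ => by rw [hQ S v hv]
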